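/- Let $SU(4)$ act on the unit sphere $S^7\subset\mathbb{C}^4$ in the standard way, so that $S^7=SU(4)/SU(3)$, where $SU(3)$ is the stabiliser of $p_0=(1,0,0,0)$. A 3-form $\varphi$ on $S^7$ is positive if at every point $\tfrac16\,\iota_X\varphi\wedge\iota_Y\varphi\wedge\varphi=g_\varphi(X,Y)\,\mathrm{dvol}_\varphi$ for an inner product $g_\varphi$ and its volume form $\mathrm{dvol}_\varphi$ (for one of the two orientations); these are determined by $\varphi$. Let $*_\varphi$ be the associated Hodge star and $\Delta_\varphi=*_\varphi d*_\varphi d-d*_\varphi d*_\varphi$ the Hodge Laplacian on 3-forms. The $G_2$-Laplacian is the map $\varphi\mapsto\Delta_\varphi\varphi$. Let $\mathcal P$ be the set of smooth $SU(4)$-invariant positive 3-forms on $S^7$, with the topology of pointwise convergence. Let $\xi_1,\xi_2,\xi_3$ be the standard basis of $\mathbb{C}^3$ and put $$e_1=\begin{pmatrix}3i&0\\0&-iI_3\end{pmatrix},\quad e_{2j}=\begin{pmatrix}0&-\xi_j^T\\ \xi_j&0\end{pmatrix},\quad e_{2j+1}=\begin{pmatrix}0&i\xi_j^T\\ i\xi_j&0\end{pmatrix}\qquad(j=1,2,3).$$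 Identify their real span with $T_{p_0}S^7$ through $X\mapsto Xp_0$, let $e^1,\dots,e^7$ be the dual basis, and put $\omega=e^{23}+e^{45}+e^{67}$, $V_R=e^{246}-e^{257}-e^{347}-e^{356}$, $V_I=e^{346}-e^{357}+e^{247}+e^{256}$. These are $SU(3)$-invariant, and an $SU(4)$-invariant form on $S^7$ is identified with its value at $p_0$. (1) The forms in $\mathcal P$ are exactly the forms $\varphi=A^3\,e^1\wedge\omega+R^3\cos\alpha\,V_R+R^3\sin\alpha\,V_I$ with $A\in\mathbb{R}\setminus\{0\}$, $R>0$ and $\alpha\in\mathbb{R}$: every form in $\mathcal P$ is of this kind, and for all such $A,R,\alpha$ there is exactly one form in $\mathcal P$ with this value at $p_0$. (2) The $G_2$-Laplacian maps $\mathcal P$ bijectively onto $\mathcal P$, and it preserves orientation: for every $\varphi\in\mathcal P$, the positive 3-forms $\varphi$ and $\Delta_\varphi\varphi$ induce the same orientation of $S^7$. (3) For $\varphi$ as in (1), $$\Delta_\varphi\varphi=\tfrac{16}{9}A^9R^{-8}\,e^1\wedge\omega+144A^{-6}R^7\left(\cos\alpha\,V_R+\sin\alpha\,V_I\right);$$ in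 particular the angle $\alpha$ is unchanged. (4) The set of fixed points $\{\varphi\in\mathcal P:\Delta_\varphi\varphi=\varphi\}$ is the union of exactly two disjoint circles, namely those given by $A=4\cdot3^{1/3}$, $R=4$, $\alpha$ arbitrary, and by $A=-4\cdot3^{1/3}$, $R=4$, $\alpha$ arbitrary; each of them is homeomorphic to $S^1$. -/

import Mathlib

noncomputable section

namespace G2Sphere

/-! ### Multilinear algebra: wedge products, positive 3-forms, Hodge star -/

section LinearAlgebra

variable {V : Type*} [NormedAddCommGroup V] [NormedSpace ℝ V]

/-- The wedge product of alternating forms, normalised as the sum over shuffles, so that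
`(e¹ ∧ e²)(e₁, e₂) = 1`. -/
def wedge {k l : ℕ} (α : V [⋀^Fin k]→ₗ[ℝ] ℝ) (β : V [⋀^Fin l]→ₗ[ℝ] ℝ) :
    V [⋀^Fin (k + l)]→ₗ[ℝ] ℝ :=
  ((LinearMap.mul' ℝ ℝ).compAlternatingMap (α.domCoprod β)).domDomCongr finSumFinEquiv

/-- The 7-form `(1/6) ι_X φ ∧ ι_Y φ ∧ φ` attached to a 3-form `φ` and two vectors `X`, `Y`. -/
def sevenForm (φ : V [⋀^Fin 3]→L[ℝ] ℝ) (X Y : V) : V [⋀^Fin 7]→ₗ[ℝ] ℝ :=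
  (1 / 6 : ℝ) •
    wedge (wedge (φ.toAlternatingMap.curryLeft X) (φ.toAlternatingMap.curryLeft Y))
      φ.toAlternatingMap

/-- The basis `b` of `V` is orthonormal for `g` and has volume `1` for the top form `vol`. -/
def IsOrientedFrame {n : ℕ} (g : LinearMap.BilinForm ℝ V) (vol : V [⋀^Fin n]→L[ℝ] ℝ)
    (b : Module.Basis (Fin n) ℝ V) : Prop :=
  (∀ i j, g (b i) (b j) = if i = j then 1 else 0) ∧ vol b = 1

/-- `g` is an inner product, `vol` is its volume form for one of the two orientations, and
`(1/6) ι_X φ ∧ ι_Y φ ∧ φ = g(X, Y) vol` for all `X`, `Y`. -/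
structure Induces (φ : V [⋀^Fin 3]→L[ℝ] ℝ) (g : LinearMap.BilinForm ℝ V)
    (vol : V [⋀^Fin 7]→L[ℝ] ℝ) : Prop where
  symm : ∀ X Y, g X Y = g Y X
  posDef : ∀ X, X ≠ 0 → 0 < g X X
  volume : ∃ b : Module.Basis (Fin 7) ℝ V, IsOrientedFrame g vol b
  relation : ∀ X Y, sevenForm φ X Y = g X Y • vol.toAlternatingMap

/-- A 3-form on a 7-dimensional space is positive if it induces an inner product. -/
def IsPositive (φ : V [⋀^Fin 3]→L[ℝ] ℝ) : Prop :=
  ∃ (g : LinearMap.BilinForm ℝ V) (vol : V [⋀^Fin 7]→L[ℝ] ℝ), Induces φ g vol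

open Classical in
/-- The inner product `g_φ` induced by a positive 3-form (which determines it uniquely). -/
def inducedMetric (φ : V [⋀^Fin 3]→L[ℝ] ℝ) : LinearMap.BilinForm ℝ V :=
  if h : IsPositive φ then h.choose else 0

open Classical in
/-- The volume form `dvol_φ` induced by a positive 3-form (which determines it uniquely). -/
def inducedVolume (φ : V [⋀^Fin 3]→L[ℝ] ℝ) : V [⋀^Fin 7]→L[ℝ] ℝ :=
  if h : IsPositive φ then h.choose_spec.choose else 0

/-- Insertion of `k` vectors in the first slots: `v ↦ η (u₁, …, u_k, v₁, …, v_l)`. -/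
def contract {l : ℕ} : (k : ℕ) → (V [⋀^Fin (l + k)]→L[ℝ] ℝ) → (Fin k → V) → V [⋀^Fin l]→L[ℝ] ℝ
  | 0, η, _ => η
  | k + 1, η, u => contract k (ContinuousAlternatingMap.curryLeft (n := l + k) η (u 0)) (Fin.tail u)

open Classical in
/-- The Hodge star from `k`-forms to `l`-forms on a space of dimension `l + k` with inner product
`g` and volume form `vol`. For any oriented orthonormal frame `b` it is given by
`(∗β)(v) = (1/k!) ∑ β(b_{i₁}, …, b_{i_k}) vol(b_{i₁}, …, b_{i_k}, v₁, …, v_l)`, the sum being over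
all `k`-tuples of indices; that is, `(∗β)(b_{k+1}, …, b_n) = β(b₁, …, b_k)` in every such frame. -/
def hodgeStar (k l : ℕ) (g : LinearMap.BilinForm ℝ V) (vol : V [⋀^Fin (l + k)]→L[ℝ] ℝ)
    (β : V [⋀^Fin k]→L[ℝ] ℝ) : V [⋀^Fin l]→L[ℝ] ℝ :=
  if h : ∃ b : Module.Basis (Fin (l + k)) ℝ V, IsOrientedFrame g vol b then
    (1 / (k.factorial : ℝ)) •
      ∑ i : Fin k → Fin (l + k),
        β (fun a => h.choose (i a)) • contract k vol (fun a => h.choose (i a))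
  else 0

end LinearAlgebra

/-! ### Differential forms on the unit sphere of `ℂ⁴` -/

/-- `ℂ⁴` with its Hermitian norm, regarded as the Euclidean space `ℝ⁸` through the real inner
product `Re ⟨x, y⟩`. -/
abbrev E : Type := EuclideanSpace ℂ (Fin 4)

/-- The 7-sphere. -/
abbrev S7 : Type := Metric.sphere (0 : E) 1

/-- The tangent space of the 7-sphere at `p`: the real orthogonal complement of `p`. -/
abbrev T (p : S7) : Submodule ℝ E := (ℝ ∙ (p : E))ᗮ

/-- (Not necessarily smooth) differential `k`-forms on the 7-sphere. -/
abbrev Form (k : ℕ) : Type := (p : S7) → (T p) [⋀^Fin k]→L[ℝ] ℝ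

/-- The point `x / ‖x‖` of the sphere. -/
def retract (x : E) (hx : x ≠ 0) : S7 :=
  ⟨(‖x‖⁻¹ : ℝ) • x, by
    rw [mem_sphere_zero_iff_norm, norm_smul, norm_inv, norm_norm,
      inv_mul_cancel₀ (norm_ne_zero_iff.mpr hx)]⟩

open Classical in
/-- The pullback of a form on the sphere under the retraction `x ↦ x / ‖x‖` of `ℝ⁸ ∖ {0}`. The
derivative of the retraction at `x` is the orthogonal projection onto the tangent space at
`x / ‖x‖`, divided by `‖x‖`. -/
def radialPullback {k : ℕ} (ω : Form k) (x : E) : E [⋀^Fin k]→L[ℝ] ℝ :=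
  if hx : x ≠ 0 then
    (ω (retract x hx)).compContinuousLinearMap
      ((‖x‖⁻¹ : ℝ) • (T (retract x hx)).orthogonalProjectionOnto)
  else 0

/-- Smoothness of a form on the sphere. -/
def IsSmooth {k : ℕ} (ω : Form k) : Prop :=
  ContDiffOn ℝ (⊤ : ℕ∞) (radialPullback ω) {x | x ≠ 0}

/-- The exterior derivative on the sphere: `dω = ι^* d (r^* ω)`, where `r` is the retraction
`x ↦ x / ‖x‖` and `ι` is the inclusion of the sphere, so that `r ∘ ι = id`. -/
def extD {k : ℕ} (ω : Form k) : Form (k + 1) := fun p =>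
  (extDeriv (radialPullback ω) (p : E)).compContinuousLinearMap (T p).subtypeL

/-- The Hodge star `∗_φ` of the metric and orientation induced by the 3-form `φ`, from 3-forms to
4-forms. -/
def star34 (φ : Form 3) (ω : Form 3) : Form 4 := fun p =>
  hodgeStar 3 4 (inducedMetric (φ p)) (inducedVolume (φ p)) (ω p)

/-- `∗_φ` from 4-forms to 3-forms. -/
def star43 (φ : Form 3) (ω : Form 4) : Form 3 := fun p =>
  hodgeStar 4 3 (inducedMetric (φ p)) (inducedVolume (φ p)) (ω p)

/-- `∗_φ` from 5-forms to 2-forms. -/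
def star52 (φ : Form 3) (ω : Form 5) : Form 2 := fun p =>
  hodgeStar 5 2 (inducedMetric (φ p)) (inducedVolume (φ p)) (ω p)

/-- The Hodge Laplacian of `φ` on 3-forms, `Δ_φ = ∗_φ d ∗_φ d - d ∗_φ d ∗_φ`. -/
def hodgeLaplacian (φ : Form 3) (ω : Form 3) : Form 3 :=
  star43 φ (extD (star43 φ (extD ω))) - extD (star52 φ (extD (star34 φ ω)))

/-- The `G₂`-Laplacian `φ ↦ Δ_φ φ`. -/
def g2Laplacian (φ : Form 3) : Form 3 := hodgeLaplacian φ φ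

/-- The positive 3-forms `φ` and `ψ` induce the same orientation of the 7-sphere. -/
def SameOrientation (φ ψ : Form 3) : Prop :=
  ∀ p, ∃ c : ℝ, 0 < c ∧ inducedVolume (ψ p) = c • inducedVolume (φ p)

/-! ### Invariance under `SU(4)` -/

/-- Invariance of a form under the standard action of `SU(4)` on the sphere in `ℂ⁴`:
`ω_{Ap}(A v₁, …, A v_k) = ω_p(v₁, …, v_k)`. -/
def IsInvariant {k : ℕ} (ω : Form k) : Prop :=
  ∀ A ∈ Matrix.specialUnitaryGroup (Fin 4) ℂ, ∀ p q : S7, (q : E) = Matrix.toEuclideanLin A p →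
    ∀ (v : Fin k → T p) (w : Fin k → T q),
      (∀ i, (w i : E) = Matrix.toEuclideanLin A (v i)) → ω q w = ω p v

/-- The `SU(4)`-invariant positive 3-forms (that is, `SU(4)`-invariant `G₂`-structures). -/
def invariantPositiveForms : Set (Form 3) :=
  {φ | IsSmooth φ ∧ IsInvariant φ ∧ ∀ p, IsPositive (φ p)}

/-! ### Coordinates -/

/-- The base point `(1, 0, 0, 0)`, whose stabiliser is `SU(3)`. -/
def basePoint : S7 := ⟨EuclideanSpace.single 0 1, by simp⟩

/-- The basis `e₁, …, e₇` (indexed here by `0, …, 6`) of the `Ad(SU(3))`-invariant complement `𝔪`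
of `𝔰𝔲(3)` in `𝔰𝔲(4)`. -/
def mBasis : Fin 7 → Matrix (Fin 4) (Fin 4) ℂ :=
  let re (j : Fin 4) : Matrix (Fin 4) (Fin 4) ℂ := Matrix.single j 0 1 - Matrix.single 0 j 1
  let im (j : Fin 4) : Matrix (Fin 4) (Fin 4) ℂ :=
    Matrix.single j 0 Complex.I + Matrix.single 0 j Complex.I
  ![Matrix.diagonal ![3 * Complex.I, -Complex.I, -Complex.I, -Complex.I],
    re 1, im 1, re 2, im 2, re 3, im 3]

/-- The tangent vector at the base point given by the infinitesimal action of `e_i`. -/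
def mVector (i : Fin 7) : T basePoint :=
  ⟨Matrix.toEuclideanLin (mBasis i) (basePoint : E), by
    rw [Submodule.mem_orthogonal_singleton_iff_inner_right]
    fin_cases i <;>
      simp [basePoint, mBasis, PiLp.inner_apply, Fin.sum_univ_four, Matrix.mulVec,
        dotProduct, Matrix.single_apply]⟩

/-- The identification of `𝔪 ≅ ℝ⁷` (through the basis `e₁, …, e₇`) with the tangent space at the
base point. -/
def mFrame : (Fin 7 → ℝ) →ₗ[ℝ] T basePoint := Fintype.linearCombination ℝ mVector

/-- The 3-form `e^i ∧ e^j ∧ e^k` on `ℝ⁷`. -/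
def coframe (i j k : Fin 7) : (Fin 7 → ℝ) [⋀^Fin 3]→ₗ[ℝ] ℝ :=
  Matrix.detRowAlternating.compLinearMap (LinearMap.funLeft ℝ ℝ ![i, j, k])

/-- `e¹ ∧ ω`, where `ω = e²³ + e⁴⁵ + e⁶⁷`. -/
def eOmega : (Fin 7 → ℝ) [⋀^Fin 3]→ₗ[ℝ] ℝ := coframe 0 1 2 + coframe 0 3 4 + coframe 0 5 6

/-- `V_R = e²⁴⁶ - e²⁵⁷ - e³⁴⁷ - e³⁵⁶`. -/
def formVR : (Fin 7 → ℝ) [⋀^Fin 3]→ₗ[ℝ] ℝ :=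
  coframe 1 3 5 - coframe 1 4 6 - coframe 2 3 6 - coframe 2 4 5

/-- `V_I = e³⁴⁶ - e³⁵⁷ + e²⁴⁷ + e²⁵⁶`. -/
def formVI : (Fin 7 → ℝ) [⋀^Fin 3]→ₗ[ℝ] ℝ :=
  coframe 2 3 5 - coframe 2 4 6 + coframe 1 3 6 + coframe 1 4 5

/-- At the base point, `φ = x e¹ ∧ ω + y V_R + z V_I` (which determines an invariant form `φ`). -/
def HasCoefficients (φ : Form 3) (x y z : ℝ) : Prop :=
  (φ basePoint).toAlternatingMap.compLinearMap mFrame = x • eOmega + y • formVR + z • formVI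

/-- `φ = A³ e¹ ∧ ω + R³ cos α V_R + R³ sin α V_I`. -/
def HasCoordinates (φ : Form 3) (A R α : ℝ) : Prop :=
  HasCoefficients φ (A ^ 3) (R ^ 3 * Real.cos α) (R ^ 3 * Real.sin α)

/-- The circle of invariant positive 3-forms with given coordinates `A`, `R` and arbitrary `α`. -/
def coordinateCircle (A R : ℝ) : Set (Form 3) :=
  {φ | φ ∈ invariantPositiveForms ∧ ∃ α : ℝ, HasCoordinates φ A R α}

end G2Sphere

end

noncomputable section

namespace G2Sphere

/-! ### Elementary alternating forms in a basis: determinants, signs and wedge products. -/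

section FrameAlgebra

variable {V : Type*} [NormedAddCommGroup V] [NormedSpace ℝ V]

/-! Every invariant 3-form on the sphere comes from a constant 4-form on `ℂ⁴`. Contracting `theta x
c`, that is `(x/6) ω ∧ ω + Re (c dz¹ ∧ dz² ∧ dz³ ∧ dz⁴)`, with the position vector gives `psi x c`,
whose value at the base point is `x e¹ ∧ ω + y V_R + z V_I` for `c = y - iz`. Three elements of
`SU(3)` that permute the frame up to sign already rule out any other value
(`exists_hasCoefficients`), and transitivity of `SU(4)` propagates the value over the sphere
(`eq_of_hasCoefficients`). Positivity excludes exactly `x = 0` and `c = 0`.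

The exterior derivative becomes algebra: for the cone form of a constant `(k+1)`-form `C`, it is `k
+ 1` times the restriction of `C` (`extD_coneForm`), and restrictions of constant forms are closed
(`extD_restrictForm`).

The Hodge star is computed in adapted frames. A unitary matrix acts on `theta x c` only by
multiplying `c` by its determinant (`theta_unitary`), so the phase of `c` is absorbed by moving the
base point with a matrix of suitable determinant in `U(4)` rather than `SU(4)`. After rescaling by
`s = R²/A³` on `e₁` and `t = 1/R` on the others, `φ` becomes the standard positive form
(`standard_psi`). The standard form has its basis as oriented orthonormal frame, whichever inducing
pair is chosen (`Induces.isOrientedFrame_standard`).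

Consequently `∗φ` is the restriction of a constant form, hence closed, and `Δφ = ∗d∗dφ`. The
operator `∗d` is diagonal on the pair `(X, Y)` of coefficients, with factors `(4/3) A³/R⁴` and `12
R²/A³` (`star43_extD_psi`). Applying it twice gives the formula for the Laplacian
(`g2Laplacian_psi`). Bijectivity and the fixed points are then questions about monomials in `A` and
`R`, and each fixed circle is the continuous injective image of the unit circle of phases. -/

theorem alternatingMap_sum_apply {ι : Type*} {k : ℕ} (s : Finset ι)
    (g : ι → V [⋀^Fin k]→ₗ[ℝ] ℝ) (v : Fin k → V) : (∑ i ∈ s, g i) v = ∑ i ∈ s, g i v := by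
  induction s using Finset.cons_induction with
  | empty => simp
  | cons a s ha ih => rw [Finset.sum_cons, Finset.sum_cons, AlternatingMap.add_apply, ih]

/-- The elementary form `f^{I 0} ∧ … ∧ f^{I (k-1)}` of the basis dual to `f`. -/
def basisForm {n k : ℕ} (f : Module.Basis (Fin n) ℝ V) (I : Fin k → Fin n) :
    V [⋀^Fin k]→ₗ[ℝ] ℝ :=
  MultilinearMap.alternatization
    ((MultilinearMap.mkPiAlgebra ℝ (Fin k) ℝ).compLinearMap (fun a => f.coord (I a)))

theorem basisForm_apply {n k : ℕ} (f : Module.Basis (Fin n) ℝ V) (I : Fin k → Fin n)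
    (v : Fin k → V) :
    basisForm f I v = (Matrix.of fun a b => f.coord (I a) (v b)).det := by
  rw [← Matrix.det_transpose, Matrix.det_apply, basisForm, MultilinearMap.alternatization_apply]
  refine Finset.sum_congr rfl fun σ _ => ?_
  simp

/-- The sign of `I` as a permutation of `Fin n`, and `0` if `I` is not one. -/
def indexSign {n : ℕ} (I : Fin n → Fin n) : ℤ :=
  ∏ j, ∏ i ∈ Finset.Ioi j, if I j < I i then 1 else if I i < I j then -1 else 0

/-- The matrix to be evaluated is the identity with its rows rearranged by `I`, so its determinant
is a sign, or zero if a row repeats. The integer product on the right can be evaluated by decision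
procedures. -/
theorem basisForm_self {n : ℕ} (f : Module.Basis (Fin n) ℝ V) (I : Fin n → Fin n) :
    basisForm f I f = indexSign I := by
  rw [basisForm_apply]
  have hm : (Matrix.of fun a b => f.coord (I a) (f b)) =
      (1 : Matrix (Fin n) (Fin n) ℝ).submatrix I id := by
    ext a b
    simp [Matrix.one_apply, Finsupp.single_apply, eq_comm]
  rw [hm]
  by_cases hI : Function.Injective I
  · let σ : Equiv.Perm (Fin n) := Equiv.ofBijective I (Finite.injective_iff_bijective.mp hI)
    have : (1 : Matrix (Fin n) (Fin n) ℝ).submatrix I id =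
      (1 : Matrix (Fin n) (Fin n) ℝ).submatrix σ id := rfl
    rw [this, Matrix.det_permute, Matrix.det_one, mul_one, Equiv.Perm.sign_eq_prod_prod_Ioi,
      indexSign]
    push_cast
    refine Finset.prod_congr rfl fun j _ => Finset.prod_congr rfl fun i hi => ?_
    have hne : I j ≠ I i := fun h => (Finset.mem_Ioi.mp hi).ne (hI h)
    change (((if I j < I i then 1 else -1 : ℤˣ) : ℤ) : ℝ) = _
    rcases lt_or_gt_of_ne hne with h | h
    · simp [h]
    · simp [h, not_lt_of_gt h]
  · have : ∃ i j, j < i ∧ I j = I i := by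
      simp only [Function.Injective, not_forall] at hI
      obtain ⟨a, b, hab, hne⟩ := hI
      rcases lt_or_gt_of_ne hne with h | h
      · exact ⟨b, a, h, hab⟩
      · exact ⟨a, b, h, hab.symm⟩
    obtain ⟨i, j, hlt, he⟩ := this
    rw [Matrix.det_zero_of_row_eq hlt.ne]
    · rw [indexSign, Finset.prod_eq_zero (Finset.mem_univ j)]
      · simp
      · exact Finset.prod_eq_zero (Finset.mem_Ioi.mpr hlt) (by simp [he])
    · ext b
      change (1 : Matrix (Fin n) (Fin n) ℝ) (I j) b = (1 : Matrix (Fin n) (Fin n) ℝ) (I i) b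
      rw [he]

/-- This is Laplace expansion of the determinant along its first column. -/
theorem basisForm_curryLeft {n k : ℕ} (f : Module.Basis (Fin n) ℝ V) (I : Fin (k + 1) → Fin n)
    (x : V) : (basisForm f I).curryLeft x =
      ∑ a : Fin (k + 1), ((-1) ^ (a : ℕ) * f.coord (I a) x) • basisForm f (I ∘ a.succAbove) := by
  ext v
  rw [AlternatingMap.curryLeft_apply_apply, basisForm_apply, Matrix.det_succ_column_zero]
  refine Eq.trans ?_ (alternatingMap_sum_apply _ _ v).symm
  refine Finset.sum_congr rfl fun a _ => ?_
  rw [AlternatingMap.smul_apply, basisForm_apply]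
  rfl

/-! ### Wedge products -/

/-- The wedge product as a bilinear map. -/
def wedgeₗ (V : Type*) [NormedAddCommGroup V] [NormedSpace ℝ V] (k l : ℕ) :
    (V [⋀^Fin k]→ₗ[ℝ] ℝ) →ₗ[ℝ] (V [⋀^Fin l]→ₗ[ℝ] ℝ) →ₗ[ℝ] (V [⋀^Fin (k + l)]→ₗ[ℝ] ℝ) :=
  LinearMap.mk₂ ℝ wedge
    (fun α α' β => by
      ext v
      simp only [wedge, ← AlternatingMap.domCoprod'_apply, TensorProduct.add_tmul, map_add]
      simp)
    (fun c α β => by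
      ext v
      simp only [wedge, ← AlternatingMap.domCoprod'_apply, ← TensorProduct.smul_tmul', map_smul]
      simp)
    (fun α β β' => by
      ext v
      simp only [wedge, ← AlternatingMap.domCoprod'_apply, TensorProduct.tmul_add, map_add]
      simp)
    (fun c α β => by
      ext v
      simp only [wedge, ← AlternatingMap.domCoprod'_apply, TensorProduct.tmul_smul, map_smul]
      simp)

theorem wedgeₗ_apply {k l : ℕ} (α : V [⋀^Fin k]→ₗ[ℝ] ℝ) (β : V [⋀^Fin l]→ₗ[ℝ] ℝ) :
    wedgeₗ V k l α β = wedge α β := rfl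

/-- Alternatization commutes with the shuffle product, so both sides alternatize the same product of
coordinate functions. -/
theorem wedge_basisForm {n k l : ℕ} (f : Module.Basis (Fin n) ℝ V) (I : Fin k → Fin n)
    (J : Fin l → Fin n) :
    wedge (basisForm f I) (basisForm f J) = basisForm f (Fin.append I J) := by
  ext v
  rw [wedge, basisForm, basisForm, ← MultilinearMap.domCoprod_alternization, basisForm_apply,
    ← Matrix.det_transpose, Matrix.det_apply]
  simp only [AlternatingMap.domDomCongr_apply, LinearMap.compAlternatingMap_apply,
    MultilinearMap.alternatization_apply, map_sum]
  refine Fintype.sum_equiv (Equiv.permCongr finSumFinEquiv) _ _ fun σ => ?_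
  rw [Equiv.Perm.sign_permCongr]
  simp [Fin.prod_univ_add]

end FrameAlgebra

/-! ### The standard positive 3-form and the uniqueness of its metric and volume. -/

section StandardForm

variable {V : Type*} [NormedAddCommGroup V] [NormedSpace ℝ V]

/-- In a basis, an alternating map is a polynomial in the coordinates of its arguments. -/
theorem continuous_alternatingMap [FiniteDimensional ℝ V] {k : ℕ} (η : V [⋀^Fin k]→ₗ[ℝ] ℝ) :
    Continuous η := by
  let f := Module.finBasis ℝ V
  have h : ∀ v : Fin k → V, η v =
      ∑ r : Fin k → Fin (Module.finrank ℝ V), (∏ a, f.coord (r a) (v a)) * η (f ∘ r) := by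
    intro v
    have hv : v = fun a => ∑ j, f.coord j (v a) • f j := by
      ext1 a
      exact (f.sum_repr (v a)).symm
    conv_lhs => rw [hv]
    rw [← AlternatingMap.coe_multilinearMap, MultilinearMap.map_sum]
    refine Finset.sum_congr rfl fun r _ => ?_
    exact MultilinearMap.map_smul_univ _ _ _
  have hη : (η : (Fin k → V) → ℝ) = fun v => ∑ r : Fin k → Fin (Module.finrank ℝ V),
      (∏ a, f.coord (r a) (v a)) * η (f ∘ r) := funext h
  rw [hη]
  refine continuous_finsetSum _ fun r _ => Continuous.mul ?_ continuous_const
  refine continuous_finsetProd _ fun a _ => ?_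
  exact (f.coord (r a)).continuous_of_finiteDimensional.comp (continuous_apply a)

/-- An alternating map on a finite-dimensional space as a continuous alternating map. -/
def toContinuous [FiniteDimensional ℝ V] {k : ℕ} (η : V [⋀^Fin k]→ₗ[ℝ] ℝ) :
    V [⋀^Fin k]→L[ℝ] ℝ :=
  { η with cont := continuous_alternatingMap η }

theorem topForm_eq_smul {n : ℕ} (f : Module.Basis (Fin n) ℝ V) (η : V [⋀^Fin n]→ₗ[ℝ] ℝ) :
    η = η f • f.det := η.eq_smul_basis_det f

/-! ### Oriented frames -/

/-- Two orthonormal bases differ by an orthogonal matrix, whose determinant squares to one. -/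
theorem IsOrientedFrame.sq_apply_eq_one {n : ℕ} {g : LinearMap.BilinForm ℝ V}
    {vol : V [⋀^Fin n]→L[ℝ] ℝ} {b : Module.Basis (Fin n) ℝ V} (hb : IsOrientedFrame g vol b)
    (b' : Module.Basis (Fin n) ℝ V) (h : ∀ i j, g (b' i) (b' j) = if i = j then 1 else 0) :
    vol b' ^ 2 = 1 := by
  have h1 : vol b' = (b.toMatrix b').det := by
    have := congrArg (fun η => η b') (topForm_eq_smul b vol.toAlternatingMap)
    simpa [hb.2, Module.Basis.det_apply] using this
  have h2 : (b.toMatrix b').transpose * b.toMatrix b' = 1 := by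
    ext i j
    have hs : ∀ k, b' k = ∑ l, b.toMatrix b' l k • b l := fun k => by
      simp [Module.Basis.toMatrix_apply, b.sum_repr]
    have := h i j
    rw [hs i, hs j] at this
    simp only [map_sum, LinearMap.sum_apply, map_smul, LinearMap.smul_apply, hb.1, smul_eq_mul,
      mul_ite, mul_one, mul_zero, Finset.sum_ite_eq', Finset.mem_univ,
      if_true] at this
    rw [Matrix.mul_apply, Matrix.one_apply]
    simpa [mul_comm] using this
  have h3 := congrArg Matrix.det h2
  rw [Matrix.det_mul, Matrix.det_transpose, Matrix.det_one, ← h1] at h3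
  rw [sq, h3]

/-- The defining relation of a positive form fixes only the product of metric and volume, which
leaves a scale and a sign. Positive definiteness makes `t = vol f` positive. Then `√t f` is
orthonormal, so its volume `√t⁷ t` has square one, which forces `t = 1`. -/
theorem IsOrientedFrame.of_smul_eq {g : LinearMap.BilinForm ℝ V}
    {vol : V [⋀^Fin 7]→L[ℝ] ℝ} {b : Module.Basis (Fin 7) ℝ V} (hb : IsOrientedFrame g vol b)
    (hg : ∀ X, X ≠ 0 → 0 < g X X) (f : Module.Basis (Fin 7) ℝ V)
    (h : ∀ i j, g (f i) (f j) * vol f = if i = j then 1 else 0) :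
    IsOrientedFrame g vol f := by
  set t := vol f with ht
  have ht0 : 0 < t := by
    have h0 := h 0 0
    have hp := hg (f 0) (f.ne_zero 0)
    simp only [if_true] at h0
    by_contra hc
    nlinarith [mul_nonneg hp.le (neg_nonneg.mpr (not_lt.mp hc))]
  have hs : Real.sqrt t ≠ 0 := (Real.sqrt_pos.mpr ht0).ne'
  have hs2 : Real.sqrt t * Real.sqrt t = t := Real.mul_self_sqrt ht0.le
  let f' := f.isUnitSMul (w := fun _ => Real.sqrt t) (fun _ => hs.isUnit)
  have hf' : ∀ i, f' i = Real.sqrt t • f i := fun i => f.isUnitSMul_apply _ i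
  have h1 := hb.sq_apply_eq_one f' (fun i j => by
    rw [hf', hf']
    simp only [map_smul, LinearMap.smul_apply, smul_eq_mul]
    rw [← mul_assoc, hs2, mul_comm, h])
  have h2 : vol f' = Real.sqrt t ^ 7 * t := by
    have : (f' : Fin 7 → V) = fun i => Real.sqrt t • f i := funext hf'
    rw [this]
    have := vol.toAlternatingMap.toMultilinearMap.map_smul_univ (fun _ => Real.sqrt t) f
    simp only [Finset.prod_const, Finset.card_univ, Fintype.card_fin, smul_eq_mul] at this
    exact this
  rw [h2] at h1
  have h3 : Real.sqrt t ^ 18 = 1 := by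
    calc Real.sqrt t ^ 18 = (Real.sqrt t ^ 7 * (Real.sqrt t * Real.sqrt t)) ^ 2 := by ring
      _ = 1 := by rw [hs2, h1]
  have h4 : Real.sqrt t = 1 := (pow_eq_one_iff_of_nonneg (Real.sqrt_nonneg t) (by norm_num)).mp h3
  have h5 : t = 1 := by rw [← hs2, h4, mul_one]
  refine ⟨fun i j => ?_, h5⟩
  have := h i j
  rwa [h5, mul_one] at this

/-! ### The standard positive 3-form in a basis -/

/-- `f¹ ∧ ω` -/
def frameOmega (f : Module.Basis (Fin 7) ℝ V) : V [⋀^Fin 3]→ₗ[ℝ] ℝ :=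
  basisForm f ![0, 1, 2] + basisForm f ![0, 3, 4] + basisForm f ![0, 5, 6]

/-- The real part of `(f² + i f³) ∧ (f⁴ + i f⁵) ∧ (f⁶ + i f⁷)`. -/
def frameRe (f : Module.Basis (Fin 7) ℝ V) : V [⋀^Fin 3]→ₗ[ℝ] ℝ :=
  basisForm f ![1, 3, 5] - basisForm f ![1, 4, 6] - basisForm f ![2, 3, 6] -
    basisForm f ![2, 4, 5]

/-- `ω ∧ ω / 2` -/
def frameOmegaSq (f : Module.Basis (Fin 7) ℝ V) : V [⋀^Fin 4]→ₗ[ℝ] ℝ :=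
  basisForm f ![1, 2, 3, 4] + basisForm f ![1, 2, 5, 6] + basisForm f ![3, 4, 5, 6]

/-- The wedge product of `f¹` and the imaginary part of
`(f² + i f³) ∧ (f⁴ + i f⁵) ∧ (f⁶ + i f⁷)`. -/
def frameIm (f : Module.Basis (Fin 7) ℝ V) : V [⋀^Fin 4]→ₗ[ℝ] ℝ :=
  basisForm f ![0, 2, 3, 5] - basisForm f ![0, 2, 4, 6] + basisForm f ![0, 1, 3, 6] +
    basisForm f ![0, 1, 4, 5]

/-- The indices of the terms of `f¹ ∧ ω + Re (f² + i f³) ∧ (f⁴ + i f⁵) ∧ (f⁶ + i f⁷)`. -/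
def termIndex : Fin 7 → Fin 3 → Fin 7 :=
  ![![0, 1, 2], ![0, 3, 4], ![0, 5, 6], ![1, 3, 5], ![1, 4, 6], ![2, 3, 6], ![2, 4, 5]]

/-- The signs of the terms of `f¹ ∧ ω + Re (f² + i f³) ∧ (f⁴ + i f⁵) ∧ (f⁶ + i f⁷)`. -/
def termSign : Fin 7 → ℤ := ![1, 1, 1, 1, -1, -1, -1]

theorem frameOmega_add_frameRe (f : Module.Basis (Fin 7) ℝ V) :
    frameOmega f + frameRe f = ∑ t, (termSign t : ℝ) • basisForm f (termIndex t) := by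
  simp only [Fin.sum_univ_seven, termSign, termIndex, frameOmega, frameRe]
  simp only [Matrix.cons_val, Int.cast_one, Int.cast_neg, one_smul]
  module

/-- The sign of a pair of indices. -/
def pairSign (a b : Fin 7) : ℤ := if a < b then 1 else if b < a then -1 else 0

/-- The sign of a permutation of seven indices, given in blocks of two, two and three. -/
def blockSign (I J : Fin 2 → Fin 7) (K : Fin 3 → Fin 7) : ℤ :=
  pairSign (I 0) (I 1) * pairSign (J 0) (J 1) * pairSign (K 0) (K 1) *
  pairSign (K 0) (K 2) * pairSign (K 1) (K 2) *
  (pairSign (I 0) (J 0) * pairSign (I 0) (J 1) * pairSign (I 1) (J 0) * pairSign (I 1) (J 1) *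
  (pairSign (I 0) (K 0) * pairSign (I 0) (K 1) * pairSign (I 0) (K 2) *
    pairSign (I 1) (K 0) * pairSign (I 1) (K 1) * pairSign (I 1) (K 2) *
  (pairSign (J 0) (K 0) * pairSign (J 0) (K 1) * pairSign (J 0) (K 2) *
    pairSign (J 1) (K 0) * pairSign (J 1) (K 1) * pairSign (J 1) (K 2))))

theorem indexSign_append (I J : Fin 2 → Fin 7) (K : Fin 3 → Fin 7) :
    indexSign (n := 7) (Fin.append (Fin.append I J) K) = blockSign I J K := by
  rw [blockSign]
  set L : Fin 7 → Fin 7 := Fin.append (Fin.append I J) K with hL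
  have h0 : I 0 = L 0 := rfl
  have h1 : I 1 = L 1 := rfl
  have h2 : J 0 = L 2 := rfl
  have h3 : J 1 = L 3 := rfl
  have h4 : K 0 = L 4 := rfl
  have h5 : K 1 = L 5 := rfl
  have h6 : K 2 = L 6 := rfl
  rw [h0, h1, h2, h3, h4, h5, h6]
  have h : indexSign L = ∏ j, ∏ i, if j < i then pairSign (L j) (L i) else 1 := by
    refine Finset.prod_congr rfl fun j _ => ?_
    rw [← Finset.prod_filter]
    refine Finset.prod_congr ?_ fun _ _ => rfl
    ext i
    simp
  rw [h]
  simp only [Fin.prod_univ_seven, Fin.lt_def, Fin.val_zero, Fin.val_one]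
  norm_num
  ring

/-- The combinatorial core of the standard form: `ι_{f_i} φ ∧ ι_{f_j} φ ∧ φ = 6 δ_{ij} vol`,
expanded over the seven terms of `φ` and checked by finite evaluation. -/
theorem termSign_contraction : ∀ i j : Fin 7,
    (∑ r, termSign r * ∑ s, ∑ b : Fin 3, if termIndex s b = j then
      termSign s * (-1) ^ (b : ℕ) * ∑ t, ∑ a : Fin 3, if termIndex t a = i then
        termSign t * (-1) ^ (a : ℕ) *
          blockSign (termIndex t ∘ a.succAbove) (termIndex s ∘ b.succAbove) (termIndex r)
      else 0 else 0) = if i = j then 6 else 0 := by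
  decide +kernel

/-- The map `X, Y ↦ (1/6) ι_X φ ∧ ι_Y φ ∧ φ` as a bilinear map. -/
def sevenFormₗ (φ : V [⋀^Fin 3]→L[ℝ] ℝ) : V →ₗ[ℝ] V →ₗ[ℝ] (V [⋀^Fin 7]→ₗ[ℝ] ℝ) :=
  LinearMap.mk₂ ℝ (sevenForm φ)
    (fun X X' Y => by simp only [sevenForm, ← wedgeₗ_apply, map_add, LinearMap.add_apply, smul_add])
    (fun c X Y => by
      simp only [sevenForm, ← wedgeₗ_apply, map_smul, LinearMap.smul_apply]
      rw [smul_comm])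
    (fun X Y Y' => by simp only [sevenForm, ← wedgeₗ_apply, map_add, LinearMap.add_apply, smul_add])
    (fun c X Y => by
      simp only [sevenForm, ← wedgeₗ_apply, map_smul, LinearMap.smul_apply]
      rw [smul_comm])

theorem sevenFormₗ_apply (φ : V [⋀^Fin 3]→L[ℝ] ℝ) (X Y : V) :
    sevenFormₗ φ X Y = sevenForm φ X Y := rfl

theorem sevenForm_standard {φ : V [⋀^Fin 3]→L[ℝ] ℝ} {f : Module.Basis (Fin 7) ℝ V}
    (h : φ.toAlternatingMap = frameOmega f + frameRe f) (i j : Fin 7) :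
    sevenForm φ (f i) (f j) f = if i = j then 1 else 0 := by
  have hc : ∀ i, (φ.toAlternatingMap.curryLeft (f i) : V [⋀^Fin 2]→ₗ[ℝ] ℝ) =
      ∑ t, ∑ a : Fin 3, (if termIndex t a = i then (termSign t : ℝ) * (-1) ^ (a : ℕ) else 0) •
        basisForm f (termIndex t ∘ a.succAbove) := by
    intro i
    rw [h, frameOmega_add_frameRe]
    have : ((∑ t, (termSign t : ℝ) • basisForm f (termIndex t)).curryLeft (f i) :
        V [⋀^Fin 2]→ₗ[ℝ] ℝ) =
        ∑ t, (termSign t : ℝ) • (basisForm f (termIndex t)).curryLeft (f i) := by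
      ext v
      rw [AlternatingMap.curryLeft_apply_apply, alternatingMap_sum_apply,
        alternatingMap_sum_apply]
      rfl
    rw [this]
    refine Finset.sum_congr rfl fun t _ => ?_
    rw [basisForm_curryLeft, Finset.smul_sum]
    refine Finset.sum_congr rfl fun a _ => ?_
    rw [smul_smul]
    congr 1
    by_cases hi : termIndex t a = i
    · simp [hi]
    · simp [hi]
  rw [sevenForm, hc, hc, AlternatingMap.smul_apply]
  conv_lhs => rw [h, frameOmega_add_frameRe]
  simp only [← wedgeₗ_apply, map_sum, map_smul, LinearMap.sum_apply, LinearMap.smul_apply]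
  simp only [wedgeₗ_apply, wedge_basisForm, alternatingMap_sum_apply, AlternatingMap.smul_apply,
    basisForm_self, indexSign_append]
  have := congrArg (fun z : ℤ => (1 / 6 : ℝ) * z) (termSign_contraction i j)
  push_cast at this
  simp only [smul_eq_mul, ite_mul, zero_mul]
  rw [this]
  split_ifs <;> norm_num

theorem topForm_ext {n : ℕ} (f : Module.Basis (Fin n) ℝ V) {η ζ : V [⋀^Fin n]→ₗ[ℝ] ℝ}
    (h : η f = ζ f) : η = ζ := by
  rw [topForm_eq_smul f η, topForm_eq_smul f ζ, h]

theorem indexSign_id {n : ℕ} : indexSign (id : Fin n → Fin n) = 1 := by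
  refine Finset.prod_eq_one fun j _ => Finset.prod_eq_one fun i hi => ?_
  simp [Finset.mem_Ioi.mp hi]

theorem isPositive_standard {φ : V [⋀^Fin 3]→L[ℝ] ℝ} {f : Module.Basis (Fin 7) ℝ V}
    (h : φ.toAlternatingMap = frameOmega f + frameRe f) : IsPositive φ := by
  have : FiniteDimensional ℝ V := f.finiteDimensional_of_finite
  let g : LinearMap.BilinForm ℝ V := LinearMap.mk₂ ℝ (fun X Y => ∑ k, f.coord k X * f.coord k Y)
    (fun X X' Y => by simp [add_mul, Finset.sum_add_distrib])
    (fun c X Y => by simp [Finset.mul_sum, mul_assoc])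
    (fun X Y Y' => by simp [mul_add, Finset.sum_add_distrib])
    (fun c X Y => by simp [Finset.mul_sum, mul_left_comm])
  have hg : ∀ X Y, g X Y = ∑ k, f.coord k X * f.coord k Y := fun X Y => rfl
  have hgf : ∀ i j, g (f i) (f j) = if i = j then 1 else 0 := by
    intro i j
    simp [hg, Finsupp.single_apply]
  have hv : basisForm f id f = 1 := by rw [basisForm_self, indexSign_id, Int.cast_one]
  refine ⟨g, toContinuous (basisForm f id), ⟨fun X Y => ?_, fun X hX => ?_, ⟨f, hgf, hv⟩, ?_⟩⟩
  · simp only [hg, mul_comm]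
  · rw [hg]
    obtain ⟨k, hk⟩ : ∃ k, f.coord k X ≠ 0 := by
      by_contra hc
      push Not at hc
      exact hX (f.ext_elem fun k => by simpa using hc k)
    exact Finset.sum_pos' (fun _ _ => mul_self_nonneg _)
      ⟨k, Finset.mem_univ _, mul_self_pos.mpr hk⟩
  · let G : V →ₗ[ℝ] V →ₗ[ℝ] (V [⋀^Fin 7]→ₗ[ℝ] ℝ) :=
      LinearMap.mk₂ ℝ (fun X Y => g X Y • basisForm f id)
        (fun X X' Y => by rw [map_add, LinearMap.add_apply, add_smul])
        (fun c X Y => by rw [map_smul, LinearMap.smul_apply, smul_eq_mul, mul_smul])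
        (fun X Y Y' => by rw [map_add, add_smul])
        (fun c X Y => by rw [map_smul, smul_eq_mul, mul_smul])
    -- Both sides are bilinear with values in top forms, so it suffices to test basis vectors and
    -- then to evaluate on `f`.
    have hG : sevenFormₗ φ = G := by
      refine f.ext fun i => f.ext fun j => topForm_ext f ?_
      rw [sevenFormₗ_apply, sevenForm_standard h, LinearMap.mk₂_apply, AlternatingMap.smul_apply,
        hv, hgf, smul_eq_mul, mul_one]
    intro X Y
    rw [← sevenFormₗ_apply, hG]
    rfl

/-- Since this holds for every inducing pair, the choice made in `inducedMetric` and `inducedVolume`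
is immaterial. -/
theorem Induces.isOrientedFrame_standard {φ : V [⋀^Fin 3]→L[ℝ] ℝ}
    {f : Module.Basis (Fin 7) ℝ V} (h : φ.toAlternatingMap = frameOmega f + frameRe f)
    {g : LinearMap.BilinForm ℝ V} {vol : V [⋀^Fin 7]→L[ℝ] ℝ} (hi : Induces φ g vol) :
    IsOrientedFrame g vol f := by
  obtain ⟨b, hb⟩ := hi.volume
  refine hb.of_smul_eq hi.posDef f fun i j => ?_
  rw [← sevenForm_standard h i j, hi.relation, AlternatingMap.smul_apply]
  rfl

theorem IsPositive.induces {φ : V [⋀^Fin 3]→L[ℝ] ℝ} (h : IsPositive φ) :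
    Induces φ (inducedMetric φ) (inducedVolume φ) := by
  rw [inducedMetric, inducedVolume, dif_pos h, dif_pos h]
  exact h.choose_spec.choose_spec

theorem isOrientedFrame_induced {φ : V [⋀^Fin 3]→L[ℝ] ℝ} {f : Module.Basis (Fin 7) ℝ V}
    (h : φ.toAlternatingMap = frameOmega f + frameRe f) :
    IsOrientedFrame (inducedMetric φ) (inducedVolume φ) f :=
  (isPositive_standard h).induces.isOrientedFrame_standard h

/-- A 3-form is not positive if `ι_X φ ∧ ι_X φ ∧ φ` vanishes for some `X ≠ 0`. -/
theorem IsPositive.sevenForm_ne_zero {φ : V [⋀^Fin 3]→L[ℝ] ℝ} (h : IsPositive φ) {X : V}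
    (hX : X ≠ 0) : sevenForm φ X X ≠ 0 := by
  obtain ⟨g, vol, hi⟩ := h
  obtain ⟨b, hb⟩ := hi.volume
  intro h0
  have h1 := congrArg (fun η => η b) (hi.relation X X)
  rw [h0] at h1
  have h2 : (0 : ℝ) = g X X * vol b := h1
  rw [hb.2, mul_one] at h2
  exact (hi.posDef X hX).ne h2

end StandardForm

/-! ### The Hodge star in an arbitrary oriented orthonormal frame. -/

section HodgeStar

variable {V : Type*} [NormedAddCommGroup V] [NormedSpace ℝ V]

/-- The concatenation of a `k`-tuple and an `l`-tuple. -/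
def concat {α : Type*} {k l : ℕ} (u : Fin k → α) (v : Fin l → α) : Fin (l + k) → α :=
  Fin.append u v ∘ Fin.cast (Nat.add_comm l k)

/-- The position of the entries of the first tuple in a concatenation. -/
def concatIndex {k : ℕ} (l : ℕ) (a : Fin k) : Fin (l + k) :=
  Fin.cast (Nat.add_comm k l) (Fin.castAdd l a)

theorem comp_concat {α β : Type*} {k l : ℕ} (f : α → β) (u : Fin k → α) (v : Fin l → α) :
    f ∘ concat u v = concat (f ∘ u) (f ∘ v) := by
  ext i
  simp only [concat, Function.comp_apply]
  refine Fin.addCases (fun a => ?_) (fun a => ?_) (Fin.cast (Nat.add_comm l k) i) <;> simp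

theorem concatIndex_injective {k : ℕ} (l : ℕ) :
    Function.Injective (concatIndex (k := k) l) := by
  intro a b h
  simpa [concatIndex, Fin.ext_iff] using h

theorem concat_concatIndex {α : Type*} {k l : ℕ} (u : Fin k → α) (v : Fin l → α) (a : Fin k) :
    concat u v (concatIndex l a) = u a := by
  simp [concat, concatIndex]

theorem concat_update {α : Type*} {k l : ℕ} (u : Fin k → α) (v : Fin l → α) (a : Fin k) (x : α) :
    concat (Function.update u a x) v = Function.update (concat u v) (concatIndex l a) x := by
  ext i
  obtain ⟨i, rfl⟩ : ∃ i', i = Fin.cast (Nat.add_comm k l) i' := ⟨Fin.cast (Nat.add_comm l k) i, rfl⟩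
  refine Fin.addCases (fun b => ?_) (fun b => ?_) i
  · change concat _ v (concatIndex l b) = _
    rw [concat_concatIndex]
    change _ = Function.update (concat u v) (concatIndex l a) x (concatIndex l b)
    by_cases hb : b = a
    · subst hb; simp
    · rw [Function.update_of_ne hb, Function.update_of_ne ((concatIndex_injective l).ne hb),
        concat_concatIndex]
  · rw [Function.update_of_ne]
    · simp [concat]
    · simp only [concatIndex, ne_eq, Fin.ext_iff, Fin.val_cast, Fin.val_natAdd, Fin.val_castAdd]
      omega

theorem contract_apply {l : ℕ} (k : ℕ) (η : V [⋀^Fin (l + k)]→L[ℝ] ℝ) (u : Fin k → V)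
    (v : Fin l → V) : contract k η u v = η (concat u v) := by
  induction k with
  | zero =>
    rw [contract]
    congr 1
    ext i
    simp [concat, Fin.append, Fin.addCases]
  | succ k ih =>
    rw [contract, ih]
    change η (Matrix.vecCons _ _) = _
    congr 1
    ext i
    refine Fin.cases ?_ (fun j => ?_) i
    · simp only [Matrix.cons_val_zero, concat, Function.comp_apply, Fin.append, Fin.addCases,
        Fin.val_cast, Fin.val_zero, Nat.zero_lt_succ]
      rfl
    · simp only [Matrix.cons_val_succ, concat, Function.comp_apply, Fin.append, Fin.addCases,
        Fin.val_cast, Fin.val_succ]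
      by_cases h : (j : ℕ) < k
      · simp [h, Fin.tail, Fin.castLT]
      · simp [h, Fin.subNat]

/-- `contract k η u v` as an alternating map of `u`. -/
def contractLeft {k l : ℕ} (η : V [⋀^Fin (l + k)]→L[ℝ] ℝ) (v : Fin l → V) :
    V [⋀^Fin k]→ₗ[ℝ] ℝ where
  toFun u := η (concat u v)
  map_update_add' {inst} u a x y := by
    obtain rfl : inst = instDecidableEqFin k := Subsingleton.elim _ _
    simp only [concat_update]
    exact η.toAlternatingMap.map_update_add _ _ _ _
  map_update_smul' {inst} u a c x := by
    obtain rfl : inst = instDecidableEqFin k := Subsingleton.elim _ _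
    simp only [concat_update]
    exact η.toAlternatingMap.map_update_smul _ _ _ _
  map_eq_zero_of_eq' u a b h hab := by
    refine η.toAlternatingMap.map_eq_zero_of_eq _ (i := concatIndex l a) (j := concatIndex l b) ?_
      ((concatIndex_injective l).ne hab)
    rw [concat_concatIndex, concat_concatIndex, h]

theorem contractLeft_apply {k l : ℕ} (η : V [⋀^Fin (l + k)]→L[ℝ] ℝ) (v : Fin l → V)
    (u : Fin k → V) : contractLeft η v u = contract k η u v :=
  (contract_apply k η u v).symm

/-! ### Independence of the frame -/

/-- The full contraction of two `k`-forms is invariant under orthogonal change of frame. This makes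
the Hodge star independent of the chosen frame. -/
theorem sum_multilinear_orthogonal {n k : ℕ} {M : Matrix (Fin n) (Fin n) ℝ}
    (hM : M * M.transpose = 1) {b f : Fin n → V} (hb : ∀ i, b i = ∑ j, M j i • f j)
    (F G : V [⋀^Fin k]→ₗ[ℝ] ℝ) :
    ∑ i : Fin k → Fin n, F (b ∘ i) * G (b ∘ i) = ∑ i : Fin k → Fin n, F (f ∘ i) * G (f ∘ i) := by
  have hexp : ∀ (F : V [⋀^Fin k]→ₗ[ℝ] ℝ) (i : Fin k → Fin n),
      F (b ∘ i) = ∑ r : Fin k → Fin n, (∏ a, M (r a) (i a)) * F (f ∘ r) := by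
    intro F i
    have : b ∘ i = fun a => ∑ j, M j (i a) • f j := funext fun a => hb (i a)
    rw [this, ← AlternatingMap.coe_multilinearMap, MultilinearMap.map_sum]
    exact Finset.sum_congr rfl fun r _ => MultilinearMap.map_smul_univ _ _ _
  have hprod : ∀ r s : Fin k → Fin n,
      ∑ i : Fin k → Fin n, (∏ a, M (r a) (i a)) * (∏ a, M (s a) (i a)) = if r = s then 1 else 0 := by
    intro r s
    simp only [← Finset.prod_mul_distrib]
    -- The sum over tuples of a product over slots is the product of the single-slot sums, each an
    -- entry of `M Mᵀ`.
    rw [← Fintype.piFinset_univ, ← Finset.prod_univ_sum (fun _ => Finset.univ)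
      (fun a j => M (r a) j * M (s a) j)]
    have : ∀ a, ∑ j, M (r a) j * M (s a) j = if r a = s a then 1 else 0 := by
      intro a
      have := congrFun (congrFun hM (r a)) (s a)
      rwa [Matrix.mul_apply, Matrix.one_apply] at this
    simp only [this]
    by_cases hrs : r = s
    · simp [hrs]
    · obtain ⟨a, ha⟩ := Function.ne_iff.mp hrs
      rw [if_neg hrs]
      exact Finset.prod_eq_zero (Finset.mem_univ a) (if_neg ha)
  calc ∑ i : Fin k → Fin n, F (b ∘ i) * G (b ∘ i)
      = ∑ i : Fin k → Fin n, ∑ r : Fin k → Fin n, ∑ s : Fin k → Fin n,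
          ((∏ a, M (r a) (i a)) * (∏ a, M (s a) (i a))) * (F (f ∘ r) * G (f ∘ s)) := by
        refine Finset.sum_congr rfl fun i _ => ?_
        rw [hexp F, hexp G, Finset.sum_mul_sum]
        exact Finset.sum_congr rfl fun r _ => Finset.sum_congr rfl fun s _ => by ring
    _ = ∑ r : Fin k → Fin n, ∑ s : Fin k → Fin n,
          (if r = s then 1 else 0) * (F (f ∘ r) * G (f ∘ s)) := by
        rw [Finset.sum_comm]
        refine Finset.sum_congr rfl fun r _ => ?_
        rw [Finset.sum_comm]
        refine Finset.sum_congr rfl fun s _ => ?_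
        rw [← Finset.sum_mul, hprod]
    _ = _ := by simp

theorem IsOrientedFrame.toMatrix_orthogonal {n : ℕ} {g : LinearMap.BilinForm ℝ V}
    {vol vol' : V [⋀^Fin n]→L[ℝ] ℝ} {f b : Module.Basis (Fin n) ℝ V}
    (hf : IsOrientedFrame g vol f) (hb : IsOrientedFrame g vol' b) :
    f.toMatrix b * (f.toMatrix b).transpose = 1 := by
  rw [mul_eq_one_comm]
  ext i j
  have hs : ∀ k, b k = ∑ l, f.toMatrix b l k • f l := fun k => by
    simp [Module.Basis.toMatrix_apply, f.sum_repr]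
  have := hb.1 i j
  rw [hs i, hs j] at this
  simp only [map_sum, LinearMap.sum_apply, map_smul, LinearMap.smul_apply, hf.1, smul_eq_mul,
    mul_ite, mul_one, mul_zero, Finset.sum_ite_eq', Finset.mem_univ, if_true] at this
  rw [Matrix.mul_apply, Matrix.one_apply]
  simpa [mul_comm] using this

/-- The Hodge star computed in the basis `f`. -/
def frameStar {k l : ℕ} (f : Module.Basis (Fin (l + k)) ℝ V) (vol : V [⋀^Fin (l + k)]→L[ℝ] ℝ) :
    (V [⋀^Fin k]→ₗ[ℝ] ℝ) →ₗ[ℝ] (V [⋀^Fin l]→ₗ[ℝ] ℝ) where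
  toFun η := (1 / (k.factorial : ℝ)) •
    ∑ i : Fin k → Fin (l + k), η (f ∘ i) • (contract k vol (f ∘ i)).toAlternatingMap
  map_add' η ζ := by
    simp only [AlternatingMap.add_apply, add_smul, Finset.sum_add_distrib, smul_add]
  map_smul' c η := by
    simp only [AlternatingMap.smul_apply, smul_assoc, ← Finset.smul_sum, RingHom.id_apply]
    rw [smul_comm]

theorem IsOrientedFrame.hodgeStar_eq {k l : ℕ} {g : LinearMap.BilinForm ℝ V}
    {vol : V [⋀^Fin (l + k)]→L[ℝ] ℝ} {f : Module.Basis (Fin (l + k)) ℝ V}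
    (hf : IsOrientedFrame g vol f) (β : V [⋀^Fin k]→L[ℝ] ℝ) :
    (hodgeStar k l g vol β).toAlternatingMap = frameStar f vol β.toAlternatingMap := by
  have h : ∃ b : Module.Basis (Fin (l + k)) ℝ V, IsOrientedFrame g vol b := ⟨f, hf⟩
  rw [hodgeStar, dif_pos h]
  ext v
  have hs : ∀ i, h.choose i = ∑ j, f.toMatrix h.choose j i • f j := fun i => by
    simp [Module.Basis.toMatrix_apply, f.sum_repr]
  have key := sum_multilinear_orthogonal (hf.toMatrix_orthogonal h.choose_spec) hs
    β.toAlternatingMap (contractLeft vol v)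
  simp only [contractLeft_apply] at key
  have h2 : frameStar f vol β.toAlternatingMap v = (1 / (k.factorial : ℝ)) *
      ∑ i : Fin k → Fin (l + k), β.toAlternatingMap (f ∘ i) * contract k vol (f ∘ i) v := by
    change ((1 / (k.factorial : ℝ)) • (_ : V [⋀^Fin l]→ₗ[ℝ] ℝ)) v = _
    rw [AlternatingMap.smul_apply, alternatingMap_sum_apply]
    rfl
  rw [h2, ← key]
  change (1 / (k.factorial : ℝ)) * (∑ i : Fin k → Fin (l + k),
    β (h.choose ∘ i) • contract k vol (h.choose ∘ i)) v = _
  simp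

/-! ### The Hodge star of elementary forms -/

/-- Only rearrangements of `I` contribute. The two signs of each rearrangement cancel, so all `k!`
permutations give the same term. -/
theorem sum_basisForm_smul {n k : ℕ} (f : Module.Basis (Fin n) ℝ V) (I : Fin k → Fin n)
    (c : V [⋀^Fin k]→ₗ[ℝ] ℝ) :
    ∑ i : Fin k → Fin n, basisForm f I (f ∘ i) * c (f ∘ i) = k.factorial * c (f ∘ I) := by
  have h1 : ∀ i : Fin k → Fin n, basisForm f I (f ∘ i) =
      ∑ σ : Equiv.Perm (Fin k), ((Equiv.Perm.sign σ : ℤ) : ℝ) *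
        if i = I ∘ σ.symm then 1 else 0 := by
    intro i
    rw [basisForm, MultilinearMap.alternatization_apply]
    refine Finset.sum_congr rfl fun σ _ => ?_
    rw [Units.smul_def, zsmul_eq_mul]
    congr 1
    simp only [MultilinearMap.domDomCongr_apply, MultilinearMap.compLinearMap_apply,
      MultilinearMap.mkPiAlgebra_apply, Function.comp_apply, Module.Basis.coord_apply,
      Module.Basis.repr_self, Finsupp.single_apply]
    by_cases h : i = I ∘ σ.symm
    · simp [h]
    · rw [if_neg h]
      obtain ⟨a, ha⟩ := Function.ne_iff.mp h
      refine Finset.prod_eq_zero (Finset.mem_univ (σ.symm a)) (if_neg ?_)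
      simpa using ha
  simp only [h1, Finset.sum_mul]
  rw [Finset.sum_comm]
  have h2 : ∀ σ : Equiv.Perm (Fin k), ∑ i : Fin k → Fin n,
      ((Equiv.Perm.sign σ : ℤ) : ℝ) * (if i = I ∘ σ.symm then 1 else 0) * c (f ∘ i) =
      c (f ∘ I) := by
    intro σ
    simp only [mul_ite, mul_one, mul_zero, ite_mul, zero_mul, Finset.sum_ite_eq',
      Finset.mem_univ, if_true]
    rw [← Function.comp_assoc, c.map_perm, Equiv.Perm.sign_symm, Units.smul_def, zsmul_eq_mul,
      ← mul_assoc, ← Int.cast_mul, ← Units.val_mul, Int.units_mul_self]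
    simp
  rw [Finset.sum_congr rfl fun σ _ => h2 σ]
  simp [Fintype.card_perm]

theorem frameStar_basisForm {k l : ℕ} {f : Module.Basis (Fin (l + k)) ℝ V}
    {vol : V [⋀^Fin (l + k)]→L[ℝ] ℝ} (I : Fin k → Fin (l + k)) :
    frameStar f vol (basisForm f I) = (contract k vol (f ∘ I)).toAlternatingMap := by
  ext v
  change ((1 / (k.factorial : ℝ)) • (_ : V [⋀^Fin l]→ₗ[ℝ] ℝ)) v = contract k vol (f ∘ I) v
  rw [AlternatingMap.smul_apply, alternatingMap_sum_apply, ← contractLeft_apply]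
  have := sum_basisForm_smul f I (contractLeft vol v)
  simp only [contractLeft_apply] at this ⊢
  rw [smul_eq_mul]
  refine (congrArg _ this).trans ?_
  rw [← mul_assoc, one_div, inv_mul_cancel₀ (by positivity), one_mul]

theorem topForm_comp {n : ℕ} {f : Module.Basis (Fin n) ℝ V}
    {vol : V [⋀^Fin n]→L[ℝ] ℝ} (hv : vol f = 1) (L : Fin n → Fin n) :
    vol (f ∘ L) = indexSign L := by
  have h : vol.toAlternatingMap = basisForm f id := by
    refine topForm_ext f ?_
    rw [basisForm_self, indexSign_id, Int.cast_one]
    exact hv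
  change vol.toAlternatingMap (f ∘ L) = _
  rw [h, ← basisForm_self f L, basisForm_apply, basisForm_apply, ← Matrix.det_transpose]
  congr 1
  ext a b
  simp [Finsupp.single_apply, eq_comm]

theorem injective_of_indexSign_ne_zero {n : ℕ} {I : Fin n → Fin n} (h : indexSign I ≠ 0) :
    Function.Injective I := by
  intro a b hab
  by_contra hne
  have key : ∀ i j, j < i → I j = I i → False := fun i j hlt he =>
    h (Finset.prod_eq_zero (Finset.mem_univ j)
      (Finset.prod_eq_zero (Finset.mem_Ioi.mpr hlt) (by simp [he])))
  rcases lt_or_gt_of_ne hne with h' | h'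
  · exact key b a h' hab
  · exact key a b h' hab.symm

theorem concat_natAdd {α : Type*} {k l : ℕ} (u : Fin k → α) (v : Fin l → α) (b : Fin l) :
    concat u v (Fin.cast (Nat.add_comm k l) (Fin.natAdd k b)) = v b := by
  simp [concat]

/-- A nonzero sign says that `I` and `J` together exhaust the indices, so inserting the vectors
indexed by `I` leaves only the complementary elementary form. -/
theorem contract_basis {k l : ℕ} {f : Module.Basis (Fin (l + k)) ℝ V}
    {vol : V [⋀^Fin (l + k)]→L[ℝ] ℝ} (hv : vol f = 1) {I : Fin k → Fin (l + k)}
    {J : Fin l → Fin (l + k)} {s : ℤ} (hs : indexSign (concat I J) = s) (h0 : s ≠ 0) :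
    (contract k vol (f ∘ I)).toAlternatingMap = (s : ℝ) • basisForm f J := by
  have hinj : Function.Injective (concat I J) := injective_of_indexSign_ne_zero (hs ▸ h0)
  have hJinj : Function.Injective J := fun a b hab => by
    rw [← concat_natAdd I J a, ← concat_natAdd I J b] at hab
    simpa [Fin.ext_iff] using hinj hab
  have hc : ∀ K : Fin l → Fin (l + k),
      (contract k vol (f ∘ I)).toAlternatingMap (f ∘ K) = indexSign (concat I K) := by
    intro K
    rw [← topForm_comp hv, comp_concat]
    exact contract_apply k vol (f ∘ I) (f ∘ K)
  have hJJ : basisForm f J (f ∘ J) = 1 := by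
    rw [basisForm_apply]
    have : (Matrix.of fun a b => f.coord (J a) ((f ∘ J) b)) = 1 := by
      ext a b
      simp [Finsupp.single_apply, Matrix.one_apply, hJinj.eq_iff, eq_comm]
    rw [this, Matrix.det_one]
  refine f.ext_alternating fun K hK => ?_
  change _ = ((s : ℝ) • basisForm f J) (f ∘ K)
  change (contract k vol (f ∘ I)).toAlternatingMap (f ∘ K) = _
  -- Either `K` permutes `J`, and both sides change by the same sign, or some entry of `K` already
  -- occurs in `I`, and both sides vanish.
  by_cases hr : ∀ b, K b ∈ Set.range J
  · choose τ hτ using hr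
    have hτi : Function.Injective τ := fun a b hab => hK (by rw [← hτ a, ← hτ b, hab])
    let σ : Equiv.Perm (Fin l) := Equiv.ofBijective τ (Finite.injective_iff_bijective.mp hτi)
    have hKσ : f ∘ K = (f ∘ J) ∘ σ := by
      ext b
      simp only [Function.comp_apply]
      rw [← hτ b]
      rfl
    rw [hKσ, AlternatingMap.map_perm, AlternatingMap.map_perm, hc, AlternatingMap.smul_apply, hJJ,
      hs, smul_eq_mul, mul_one]
  · push Not at hr
    obtain ⟨b, hb⟩ := hr
    obtain ⟨i, hi⟩ := (Finite.injective_iff_surjective.mp hinj) (K b)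
    obtain ⟨a, ha⟩ : ∃ a, I a = K b := by
      obtain ⟨i, rfl⟩ : ∃ i', i = Fin.cast (Nat.add_comm k l) i' :=
        ⟨Fin.cast (Nat.add_comm l k) i, rfl⟩
      induction i using Fin.addCases with
      | left a => exact ⟨a, by rw [← hi]; exact (concat_concatIndex I J a).symm⟩
      | right a => exact absurd ⟨a, by rw [← hi, concat_natAdd]⟩ hb
    have hzero : indexSign (concat I K) = 0 := by
      by_contra hne
      have hinj' := injective_of_indexSign_ne_zero hne
      have : concat I K (concatIndex l a) =
          concat I K (Fin.cast (Nat.add_comm k l) (Fin.natAdd k b)) := by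
        rw [concat_concatIndex, concat_natAdd, ha]
      have := hinj' this
      simp only [concatIndex, Fin.ext_iff, Fin.val_cast, Fin.val_castAdd, Fin.val_natAdd] at this
      omega
    rw [hc, hzero, AlternatingMap.smul_apply, basisForm_apply,
      Matrix.det_eq_zero_of_column_eq_zero b]
    · simp
    · intro a'
      have : J a' ≠ K b := fun h => hb ⟨a', h⟩
      simp [Finsupp.single_apply, this.symm]

theorem frameStar_basisForm_eq {k l : ℕ} {f : Module.Basis (Fin (l + k)) ℝ V}
    {vol : V [⋀^Fin (l + k)]→L[ℝ] ℝ} (hv : vol f = 1) {I : Fin k → Fin (l + k)}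
    (J : Fin l → Fin (l + k)) {s : ℤ} (hs : indexSign (concat I J) = s) (h0 : s ≠ 0) :
    frameStar f vol (basisForm f I) = (s : ℝ) • basisForm f J := by
  rw [frameStar_basisForm, contract_basis hv hs h0]

section Seven

variable {f : Module.Basis (Fin 7) ℝ V} {vol : V [⋀^Fin 7]→L[ℝ] ℝ}

/-- Here and in the next three computations each listed complement completes an even permutation, so
the signs come only from the coefficients of the terms. -/
theorem frameStar_frameOmega (hv : vol f = 1) :
    frameStar (k := 3) (l := 4) f vol (frameOmega f) = frameOmegaSq f := by
  rw [frameOmega, map_add, map_add,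
    frameStar_basisForm_eq (l := 4) hv ![3, 4, 5, 6] (s := 1) (by decide +kernel) (by decide),
    frameStar_basisForm_eq (l := 4) hv ![1, 2, 5, 6] (s := 1) (by decide +kernel) (by decide),
    frameStar_basisForm_eq (l := 4) hv ![1, 2, 3, 4] (s := 1) (by decide +kernel) (by decide),
    frameOmegaSq]
  push_cast
  module

theorem frameStar_frameRe (hv : vol f = 1) :
    frameStar (k := 3) (l := 4) f vol (frameRe f) = -frameIm f := by
  rw [frameRe, map_sub, map_sub, map_sub,
    frameStar_basisForm_eq (l := 4) hv ![0, 2, 4, 6] (s := 1) (by decide +kernel) (by decide),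
    frameStar_basisForm_eq (l := 4) hv ![0, 2, 3, 5] (s := 1) (by decide +kernel) (by decide),
    frameStar_basisForm_eq (l := 4) hv ![0, 1, 4, 5] (s := 1) (by decide +kernel) (by decide),
    frameStar_basisForm_eq (l := 4) hv ![0, 1, 3, 6] (s := 1) (by decide +kernel) (by decide),
    frameIm]
  push_cast
  module

theorem frameStar_frameOmegaSq (hv : vol f = 1) :
    frameStar (k := 4) (l := 3) f vol (frameOmegaSq f) = frameOmega f := by
  rw [frameOmegaSq, map_add, map_add,
    frameStar_basisForm_eq (l := 3) hv ![0, 5, 6] (s := 1) (by decide +kernel) (by decide),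
    frameStar_basisForm_eq (l := 3) hv ![0, 3, 4] (s := 1) (by decide +kernel) (by decide),
    frameStar_basisForm_eq (l := 3) hv ![0, 1, 2] (s := 1) (by decide +kernel) (by decide),
    frameOmega]
  push_cast
  module

theorem frameStar_frameIm (hv : vol f = 1) :
    frameStar (k := 4) (l := 3) f vol (frameIm f) = -frameRe f := by
  rw [frameIm, map_add, map_add, map_sub,
    frameStar_basisForm_eq (l := 3) hv ![1, 4, 6] (s := 1) (by decide +kernel) (by decide),
    frameStar_basisForm_eq (l := 3) hv ![1, 3, 5] (s := 1) (by decide +kernel) (by decide),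
    frameStar_basisForm_eq (l := 3) hv ![2, 4, 5] (s := 1) (by decide +kernel) (by decide),
    frameStar_basisForm_eq (l := 3) hv ![2, 3, 6] (s := 1) (by decide +kernel) (by decide),
    frameRe]
  push_cast
  module

end Seven

end HodgeStar

/-! ### Forms on the sphere obtained from constant forms, and their exterior derivatives. -/

section ConstantForms

open scoped RealInnerProductSpace

/-- The form on the sphere obtained by restricting a constant form. -/
def restrictForm {k : ℕ} (C : E [⋀^Fin k]→L[ℝ] ℝ) : Form k := fun p =>
  C.compContinuousLinearMap (T p).subtypeL

/-- The form on the sphere obtained by contracting a constant form with the position vector. -/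
def coneForm {k : ℕ} (C : E [⋀^Fin (k + 1)]→L[ℝ] ℝ) : Form k := fun p =>
  (C.curryLeft (p : E)).compContinuousLinearMap (T p).subtypeL

theorem restrictForm_apply {k : ℕ} (C : E [⋀^Fin k]→L[ℝ] ℝ) (p : S7) (v : Fin k → T p) :
    restrictForm C p v = C (fun i => (v i : E)) := rfl

theorem coneForm_apply {k : ℕ} (C : E [⋀^Fin (k + 1)]→L[ℝ] ℝ) (p : S7) (v : Fin k → T p) :
    coneForm C p v = C (Matrix.vecCons (p : E) (fun i => (v i : E))) := rfl

theorem sphere_ne_zero (p : S7) : (p : E) ≠ 0 := fun h => by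
  have := mem_sphere_zero_iff_norm.mp p.2
  rw [h, norm_zero] at this
  exact zero_ne_one this

theorem sphere_norm (p : S7) : ‖(p : E)‖ = 1 := mem_sphere_zero_iff_norm.mp p.2

theorem coe_retract (x : E) (hx : x ≠ 0) : (retract x hx : E) = ‖x‖⁻¹ • x := rfl

theorem coe_projection (p : S7) (v : E) :
    ((T p).orthogonalProjectionOnto v : E) = v - ⟪(p : E), v⟫ • (p : E) := by
  rw [Submodule.coe_orthogonalProjectionOnto_apply, Submodule.starProjection_orthogonal_val,
    Submodule.starProjection_unit_singleton ℝ (sphere_norm p)]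

theorem mem_tangent (p : S7) (v : E) : v ∈ T p ↔ ⟪(p : E), v⟫ = 0 :=
  Submodule.mem_orthogonal_singleton_iff_inner_right

theorem inner_tangent (p : S7) (v : T p) : ⟪(p : E), (v : E)⟫ = 0 := (mem_tangent p v).mp v.2

/-- A form which is annihilated by `x` is unchanged by adding multiples of `x` to its arguments. -/
theorem map_add_smul_of_annihilates {k : ℕ} (η : E [⋀^Fin k]→L[ℝ] ℝ) {x : E}
    (hη : ∀ (u : Fin k → E) (i : Fin k), u i = x → η u = 0) (v : Fin k → E) (a : Fin k → ℝ) :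
    η (fun i => v i + a i • x) = η v := by
  have h := η.toAlternatingMap.toMultilinearMap.map_add_univ v (fun i => a i • x)
  change η (fun i => v i + a i • x) = _ at h
  rw [h]
  -- In the expansion over subsets of slots, every term other than the one keeping all `v i` has a
  -- multiple of `x` in some slot.
  refine (Finset.sum_eq_single Finset.univ (fun s _ hs => ?_) (by simp)).trans ?_
  · obtain ⟨i, hi⟩ : ∃ i, i ∉ s := by
      by_contra hc
      push Not at hc
      exact hs (Finset.eq_univ_of_forall hc)
    set u := s.piecewise v (fun i => a i • x) with hu
    have hui : u = Function.update u i (a i • x) := by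
      rw [eq_comm, Function.update_eq_self_iff, hu, Finset.piecewise_eq_of_notMem _ _ _ hi]
    rw [hui]
    refine (η.toAlternatingMap.toMultilinearMap.map_update_smul u i (a i) x).trans ?_
    have : η (Function.update u i x) = 0 := hη _ i (by simp)
    change a i • η (Function.update u i x) = 0
    rw [this, smul_zero]
  · rw [Finset.piecewise_univ]
    rfl

theorem curryLeft_annihilates {k : ℕ} (C : E [⋀^Fin (k + 1)]→L[ℝ] ℝ) (x : E)
    (u : Fin k → E) (i : Fin k) (h : u i = x) : C.curryLeft x u = 0 := by
  refine C.toAlternatingMap.map_eq_zero_of_eq (Matrix.vecCons x u) (i := 0) (j := i.succ) ?_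
    (Fin.succ_ne_zero i).symm
  simp [h]

theorem map_const_smul {k : ℕ} (η : E [⋀^Fin k]→L[ℝ] ℝ) (c : ℝ) (v : Fin k → E) :
    η (fun i => c • v i) = c ^ k * η v := by
  have := η.toAlternatingMap.toMultilinearMap.map_smul_univ (fun _ => c) v
  simpa using this

theorem radialPullback_apply {k : ℕ} (ω : Form k) {x : E} (hx : x ≠ 0) (v : Fin k → E) :
    radialPullback ω x v = ω (retract x hx)
      (fun i => ‖x‖⁻¹ • (T (retract x hx)).orthogonalProjectionOnto (v i)) := by
  rw [radialPullback, dif_pos hx]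
  rfl

/-- The contraction with `x` already kills the radial direction, so the tangential projection is
invisible and only the powers of `‖x‖` remain: `k` from the projected arguments and one from the
normalised position vector. -/
theorem radialPullback_coneForm {k : ℕ} (C : E [⋀^Fin (k + 1)]→L[ℝ] ℝ) {x : E} (hx : x ≠ 0) :
    radialPullback (coneForm C) x = (‖x‖⁻¹ ^ (k + 1)) • C.curryLeft x := by
  ext v
  rw [radialPullback_apply _ hx]
  change C.curryLeft (‖x‖⁻¹ • x) (fun i => ((‖x‖⁻¹ •
    (T (retract x hx)).orthogonalProjectionOnto (v i) : T (retract x hx)) : E)) = _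
  have : (fun i => ((‖x‖⁻¹ • (T (retract x hx)).orthogonalProjectionOnto (v i) :
      T (retract x hx)) : E)) =
      fun i => ‖x‖⁻¹ • (v i + (-(⟪(retract x hx : E), v i⟫ * ‖x‖⁻¹)) • x) := by
    ext1 i
    rw [Submodule.coe_smul, coe_projection, coe_retract, smul_smul, neg_smul, sub_eq_add_neg]
  rw [this, map_const_smul, map_smul, ContinuousAlternatingMap.smul_apply,
    map_add_smul_of_annihilates _ (curryLeft_annihilates C x), ContinuousAlternatingMap.smul_apply,
    smul_eq_mul, smul_eq_mul]
  ring

theorem isSmooth_coneForm {k : ℕ} (C : E [⋀^Fin (k + 1)]→L[ℝ] ℝ) : IsSmooth (coneForm C) := by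
  have h : ContDiffOn ℝ (⊤ : ℕ∞) (fun x : E => (‖x‖⁻¹ ^ (k + 1)) • C.curryLeft x) {x | x ≠ 0} := by
    intro x hx
    have hn : ContDiffAt ℝ (⊤ : ℕ∞) (fun x : E => ‖x‖) x := contDiffAt_norm ℝ hx
    exact (((hn.inv (norm_ne_zero_iff.mpr hx)).pow (k + 1)).smul
      C.curryLeft.contDiff.contDiffAt).contDiffWithinAt
  exact h.congr fun x hx => radialPullback_coneForm C hx

theorem eventually_ne_zero (p : S7) : ∀ᶠ x in nhds (p : E), x ≠ 0 :=
  isOpen_ne.mem_nhds (sphere_ne_zero p)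

theorem hasFDerivAt_inv_norm {x : E} (hx : x ≠ 0) :
    HasFDerivAt (fun y : E => ‖y‖⁻¹) (-(‖x‖⁻¹ ^ 3) • innerSL ℝ x) x := by
  have hpos : 0 < ‖x‖ := norm_pos_iff.mpr hx
  have h1 : HasFDerivAt (fun y : E => ‖y‖ ^ 2) (2 • innerSL ℝ x) x :=
    (hasStrictFDerivAt_norm_sq x).hasFDerivAt
  have h2 := (h1.sqrt (pow_pos hpos 2).ne')
  simp only [Real.sqrt_sq (norm_nonneg _)] at h2
  have h3 := (hasDerivAt_inv hpos.ne').comp_hasFDerivAt x h2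
  refine HasFDerivAt.congr_fderiv h3 ?_
  ext v
  simp only [smul_apply, smul_eq_mul, nsmul_eq_mul, Nat.cast_ofNat]
  field_simp

/-- The derivative of the power of the norm is radial and vanishes on tangent vectors. What is left
is the antisymmetrisation of the linear map `x ↦ C(x, ·)`, which is `(k + 1) C`. -/
theorem extD_coneForm {k : ℕ} (C : E [⋀^Fin (k + 1)]→L[ℝ] ℝ) :
    extD (coneForm C) = restrictForm ((k + 1 : ℝ) • C) := by
  funext p
  ext v
  have he : radialPullback (coneForm C) =ᶠ[nhds (p : E)]
      fun x : E => (‖x‖⁻¹ ^ (k + 1)) • C.curryLeft x := by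
    filter_upwards [eventually_ne_zero p] with x hx using radialPullback_coneForm C hx
  have hd : HasFDerivAt (fun x : E => (‖x‖⁻¹ ^ (k + 1)) • C.curryLeft x) _ (p : E) :=
    ((hasFDerivAt_inv_norm (sphere_ne_zero p)).pow (k + 1)).smul
    (C.curryLeft.hasFDerivAt (x := (p : E)))
  change extDeriv (radialPullback (coneForm C)) (p : E) (fun i => (v i : E)) = _
  rw [he.extDeriv_eq, extDeriv, hd.fderiv, ContinuousAlternatingMap.alternatizeUncurryFin_apply]
  have h2 := congrArg (fun η => η (fun i => (v i : E)))
    (ContinuousAlternatingMap.alternatizeUncurryFin_curryLeft C)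
  simp only [ContinuousAlternatingMap.alternatizeUncurryFin_apply] at h2
  refine Eq.trans (Finset.sum_congr rfl fun i _ => ?_) (h2.trans ?_)
  · congr 1
    simp [inner_tangent]
  · rw [restrictForm_apply]
    simp [add_smul]

/-- The radial extension is the pullback of the constant form `C` under `x ↦ x / ‖x‖`, and the
exterior derivative commutes with pullback. -/
theorem extD_restrictForm {k : ℕ} (C : E [⋀^Fin k]→L[ℝ] ℝ) : extD (restrictForm C) = 0 := by
  funext p
  ext v
  let f : E → E := fun x => ‖x‖⁻¹ • x
  have hf : ∀ x : E, x ≠ 0 → HasFDerivAt f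
      (‖x‖⁻¹ • ContinuousLinearMap.id ℝ E + (-(‖x‖⁻¹ ^ 3) • innerSL ℝ x).smulRight x) x :=
    fun x hx => (hasFDerivAt_inv_norm hx).smul (hasFDerivAt_id x)
  have he : radialPullback (restrictForm C) =ᶠ[nhds (p : E)]
      fun x : E => C.compContinuousLinearMap (fderiv ℝ f x) := by
    filter_upwards [eventually_ne_zero p] with x hx
    ext u
    rw [radialPullback_apply _ hx, restrictForm_apply, (hf x hx).fderiv]
    change _ = C _
    congr 1
    ext1 i
    rw [Submodule.coe_smul, coe_projection, coe_retract]
    simp [inner_smul_left, smul_smul, sub_eq_add_neg]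
    ring_nf
  change extDeriv (radialPullback (restrictForm C)) (p : E) (fun i => (v i : E)) = _
  have hsm : ContDiffAt ℝ 2 f (p : E) :=
    ((contDiffAt_norm ℝ (sphere_ne_zero p)).inv
      (norm_ne_zero_iff.mpr (sphere_ne_zero p))).smul contDiffAt_id
  have hp := extDeriv_pullback (ω := fun _ : E => C) (f := f) (x := (p : E))
    (differentiableAt_const C) hsm (by simp)
  rw [he.extDeriv_eq, hp]
  have h0 : extDeriv (fun _ : E => C) (f p) = 0 := by
    rw [extDeriv]
    simp
    exact map_zero (ContinuousAlternatingMap.alternatizeUncurryFinCLM ℝ E ℝ)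
  rw [h0]
  rfl

end ConstantForms

/-! ### Unitary matrices, frames adapted to them, and the constant 4-forms in these frames. -/

section UnitaryFrames

open scoped RealInnerProductSpace

/-- The Kähler form `Im ⟨u, v⟩` of `ℂ⁴`. -/
def kahler (u v : E) : ℝ := (inner ℂ u v).im

theorem kahler_self (u : E) : kahler u u = 0 := inner_self_im (𝕜 := ℂ) u

theorem kahler_swap (u v : E) : kahler u v = -kahler v u := by
  rw [kahler, kahler, ← inner_conj_symm, Complex.conj_im]

theorem kahler_add_left (u u' v : E) : kahler (u + u') v = kahler u v + kahler u' v := by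
  simp [kahler]

theorem kahler_add_right (u v v' : E) : kahler u (v + v') = kahler u v + kahler u v' := by
  simp [kahler]

theorem kahler_smul_right (c : ℝ) (u v : E) : kahler u (c • v) = c * kahler u v := by
  rw [kahler, kahler, ← Complex.coe_smul, inner_smul_right, Complex.im_ofReal_mul]

theorem kahler_smul_left (c : ℝ) (u v : E) : kahler (c • u) v = c * kahler u v := by
  rw [kahler_swap, kahler_smul_right, kahler_swap u v, mul_neg]

/-- Half of the square of the Kähler form of `ℂ⁴`. -/
def kahlerSq : E [⋀^Fin 4]→ₗ[ℝ] ℝ where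
  toFun v := kahler (v 0) (v 1) * kahler (v 2) (v 3) - kahler (v 0) (v 2) * kahler (v 1) (v 3) +
    kahler (v 0) (v 3) * kahler (v 1) (v 2)
  map_update_add' {inst} v i x y := by
    obtain rfl : inst = instDecidableEqFin 4 := Subsingleton.elim _ _
    fin_cases i <;> simp [Function.update, kahler_add_left, kahler_add_right] <;> ring
  map_update_smul' {inst} v i c x := by
    obtain rfl : inst = instDecidableEqFin 4 := Subsingleton.elim _ _
    fin_cases i <;> simp [Function.update, kahler_smul_left, kahler_smul_right] <;> ring
  map_eq_zero_of_eq' v i j h hij := by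
    have h10 := kahler_swap (v 1) (v 0)
    have h20 := kahler_swap (v 2) (v 0)
    have h21 := kahler_swap (v 2) (v 1)
    have h31 := kahler_swap (v 3) (v 1)
    have h32 := kahler_swap (v 3) (v 2)
    fin_cases i <;> fin_cases j <;>
      first
      | exact absurd rfl hij
      | (simp only [Fin.zero_eta, Fin.mk_one, Fin.reduceFinMk] at h
         simp only [h, kahler_self]
         try simp only [h10, h20, h21, h31, h32]
         ring)

/-- The real part of `c dz¹ ∧ dz² ∧ dz³ ∧ dz⁴`. -/
def complexVolume (c : ℂ) : E [⋀^Fin 4]→ₗ[ℝ] ℝ where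
  toFun v := (c * (Matrix.of fun a b => v a b).det).re
  map_update_add' {inst} v i x y := by
    obtain rfl : inst = instDecidableEqFin 4 := Subsingleton.elim _ _
    have h : ∀ z : E, (Matrix.of fun a b => (Function.update v i z) a b) =
        Matrix.updateRow (Matrix.of fun a b => v a b) i z := by
      intro z
      ext a b
      by_cases ha : a = i
      · subst ha; simp
      · simp [ha]
    rw [h, h, h, ← Complex.add_re, ← mul_add, ← Matrix.det_updateRow_add]
    rfl
  map_update_smul' {inst} v i r x := by
    obtain rfl : inst = instDecidableEqFin 4 := Subsingleton.elim _ _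
    have h : ∀ z : E, (Matrix.of fun a b => (Function.update v i z) a b) =
        Matrix.updateRow (Matrix.of fun a b => v a b) i z := by
      intro z
      ext a b
      by_cases ha : a = i
      · subst ha; simp
      · simp [ha]
    have h2 : ((r • x : E) : Fin 4 → ℂ) = (r : ℂ) • (x : Fin 4 → ℂ) := by
      ext; simp
    rw [h, h, h2, Matrix.det_updateRow_smul, mul_left_comm, Complex.re_ofReal_mul, smul_eq_mul]
  map_eq_zero_of_eq' v i j h hij := by
    rw [Matrix.det_zero_of_row_eq hij]
    · simp
    · ext b
      simp [h]

instance instFiniteDimensionalE : FiniteDimensional ℝ E := FiniteDimensional.trans ℝ ℂ E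

/-- The 4-form `(x / 6) ω ∧ ω + Re (c dz¹ ∧ dz² ∧ dz³ ∧ dz⁴)` on `ℂ⁴`. -/
def theta (x : ℝ) (c : ℂ) : E [⋀^Fin 4]→L[ℝ] ℝ :=
  toContinuous ((x / 3) • kahlerSq + complexVolume c)

theorem theta_apply (x : ℝ) (c : ℂ) (v : Fin 4 → E) :
    theta x c v = x / 3 * (kahler (v 0) (v 1) * kahler (v 2) (v 3) -
      kahler (v 0) (v 2) * kahler (v 1) (v 3) + kahler (v 0) (v 3) * kahler (v 1) (v 2)) +
      (c * (Matrix.of fun a b => v a b).det).re := rfl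

/-! ### Unitary matrices -/

theorem ofLp_toEuclideanLin (U : Matrix (Fin 4) (Fin 4) ℂ) (v : E) :
    (Matrix.toEuclideanLin U v).ofLp = U.mulVec v.ofLp := rfl

theorem inner_unitary {U : Matrix (Fin 4) (Fin 4) ℂ} (hU : U ∈ Matrix.unitaryGroup (Fin 4) ℂ)
    (u v : E) : inner ℂ (Matrix.toEuclideanLin U u) (Matrix.toEuclideanLin U v) = inner ℂ u v := by
  rw [← LinearMap.adjoint_inner_right, ← Matrix.toEuclideanLin_conjTranspose_eq_adjoint]
  congr 1
  ext i
  rw [ofLp_toEuclideanLin, ofLp_toEuclideanLin, Matrix.mulVec_mulVec,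
    ← Matrix.star_eq_conjTranspose, Matrix.mem_unitaryGroup_iff'.mp hU, Matrix.one_mulVec]

theorem real_inner_eq_re (u v : E) : ⟪u, v⟫ = (inner ℂ u v).re := by
  simp [PiLp.inner_apply, Complex.inner]

/-- The Kähler form is unitarily invariant, while the complex volume form is multiplied by the
determinant. -/
theorem theta_unitary {U : Matrix (Fin 4) (Fin 4) ℂ} (hU : U ∈ Matrix.unitaryGroup (Fin 4) ℂ)
    (x : ℝ) (c : ℂ) (v : Fin 4 → E) :
    theta x c (fun i => Matrix.toEuclideanLin U (v i)) = theta x (c * U.det) v := by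
  simp only [theta_apply, kahler, inner_unitary hU]
  congr 2
  have : (Matrix.of fun a b => Matrix.toEuclideanLin U (v a) b) =
      (Matrix.of fun a b => v a b) * U.transpose := by
    ext a b
    simp only [Matrix.of_apply, ofLp_toEuclideanLin, Matrix.mul_apply,
      Matrix.transpose_apply, Matrix.mulVec, dotProduct, mul_comm]
  rw [this, Matrix.det_mul, Matrix.det_transpose]
  ring

theorem toEuclideanLin_diagonal_basePoint (μ : ℂ) :
    Matrix.toEuclideanLin (Matrix.diagonal ![1, μ, 1, 1]) (basePoint : E) = basePoint := by
  ext i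
  rw [ofLp_toEuclideanLin, Matrix.mulVec_diagonal]
  fin_cases i <;> simp [basePoint]

/-- Every point of the sphere is the image of the base point under a unitary matrix with a
prescribed determinant. -/
theorem exists_unitary (p : S7) {c : ℂ} (hc : ‖c‖ = 1) :
    ∃ U ∈ Matrix.unitaryGroup (Fin 4) ℂ,
      Matrix.toEuclideanLin U (basePoint : E) = p ∧ U.det = c := by
  have ho : Orthonormal ℂ (({0} : Set (Fin 4)).domRestrict (fun _ => (p : E))) := by
    constructor
    · intro i
      exact sphere_norm p
    · intro i j hij
      exact absurd (Subsingleton.elim i j) hij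
  obtain ⟨b, hb⟩ := ho.exists_orthonormalBasis_extension_of_card_eq (by simp)
  have hb0 : b 0 = p := hb 0 rfl
  let W : Matrix (Fin 4) (Fin 4) ℂ := (EuclideanSpace.basisFun (Fin 4) ℂ).toBasis.toMatrix b
  have hW : W ∈ Matrix.unitaryGroup (Fin 4) ℂ :=
    (EuclideanSpace.basisFun (Fin 4) ℂ).toMatrix_orthonormalBasis_mem_unitary b
  have hWp : Matrix.toEuclideanLin W (basePoint : E) = p := by
    ext i
    rw [ofLp_toEuclideanLin, ← hb0]
    simp [W, basePoint, Module.Basis.toMatrix_apply]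
  have hdet : ‖W.det‖ = 1 := by
    have := (Matrix.det_of_mem_unitary hW)
    exact CStarRing.norm_of_mem_unitary this
  have hne : W.det ≠ 0 := fun h => by rw [h, norm_zero] at hdet; exact zero_ne_one hdet
  -- Rescaling the second column of `W` corrects the determinant without affecting the image of the
  -- base point, which is the first column.
  set μ := c / W.det with hμ
  have hμ1 : ‖μ‖ = 1 := by rw [hμ, norm_div, hc, hdet, div_one]
  have hD : Matrix.diagonal ![1, μ, 1, 1] ∈ Matrix.unitaryGroup (Fin 4) ℂ := by
    rw [Matrix.mem_unitaryGroup_iff, Matrix.star_eq_conjTranspose, Matrix.diagonal_conjTranspose,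
      Matrix.diagonal_mul_diagonal, ← Matrix.diagonal_one]
    congr 1
    ext i
    fin_cases i <;> simp [Complex.mul_conj, Complex.normSq_eq_norm_sq, hμ1]
  refine ⟨W * Matrix.diagonal ![1, μ, 1, 1], mul_mem hW hD, ?_, ?_⟩
  · have : Matrix.toEuclideanLin (W * Matrix.diagonal ![1, μ, 1, 1]) (basePoint : E) =
        Matrix.toEuclideanLin W (Matrix.toEuclideanLin (Matrix.diagonal ![1, μ, 1, 1])
          (basePoint : E)) := by
      ext i
      simp only [ofLp_toEuclideanLin, Matrix.mulVec_mulVec]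
    rw [this, toEuclideanLin_diagonal_basePoint, hWp]
  · rw [Matrix.det_mul, Matrix.det_diagonal]
    simp [Fin.prod_univ_four, hμ, mul_div_cancel₀ _ hne]


theorem real_inner_unitary {U : Matrix (Fin 4) (Fin 4) ℂ}
    (hU : U ∈ Matrix.unitaryGroup (Fin 4) ℂ) (u v : E) :
    ⟪Matrix.toEuclideanLin U u, Matrix.toEuclideanLin U v⟫ = ⟪u, v⟫ := by
  rw [real_inner_eq_re, real_inner_eq_re, inner_unitary hU]

/-- The vector with coordinates `u` with respect to the frame `s e₁, t e₂, …, t e₇`. -/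
def frameMap (s t : ℝ) : (Fin 7 → ℝ) →ₗ[ℝ] E where
  toFun u := !₂[⟨0, 3 * s * u 0⟩, ⟨t * u 1, t * u 2⟩, ⟨t * u 3, t * u 4⟩, ⟨t * u 5, t * u 6⟩]
  map_add' u v := by
    ext i
    fin_cases i <;> apply Complex.ext <;> simp <;> ring
  map_smul' c u := by
    ext i
    fin_cases i <;> apply Complex.ext <;> simp <;> ring

theorem frameMap_apply (s t : ℝ) (u : Fin 7 → ℝ) : frameMap s t u =
    !₂[⟨0, 3 * s * u 0⟩, ⟨t * u 1, t * u 2⟩, ⟨t * u 3, t * u 4⟩, ⟨t * u 5, t * u 6⟩] := rfl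

theorem frameMap_injective {s t : ℝ} (hs : s ≠ 0) (ht : t ≠ 0) :
    Function.Injective (frameMap s t) := by
  rw [injective_iff_map_eq_zero]
  intro u hu
  have h : ∀ i, frameMap s t u i = 0 := fun i => by rw [hu]; rfl
  have h0 := h 0
  have h1 := h 1
  have h2 := h 2
  have h3 := h 3
  simp [frameMap_apply, Complex.ext_iff, hs, ht] at h0 h1 h2 h3
  ext i
  fin_cases i <;> simp [h0, h1, h2, h3]

theorem frameMap_tangent (s t : ℝ) (u : Fin 7 → ℝ) : ⟪(basePoint : E), frameMap s t u⟫ = 0 := by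
  rw [real_inner_eq_re]
  simp [basePoint, frameMap_apply, EuclideanSpace.inner_single_left]

theorem coe_mFrame (u : Fin 7 → ℝ) : (mFrame u : E) = frameMap 1 1 u := by
  rw [mFrame, Fintype.linearCombination_apply]
  simp only [Fin.sum_univ_seven, Submodule.coe_add, Submodule.coe_smul, mVector]
  ext i
  fin_cases i <;> apply Complex.ext <;>
    simp [frameMap_apply, mBasis, basePoint, mul_comm]

theorem finrank_tangent (p : S7) : Module.finrank ℝ (T p) = 7 := by
  have : Fact (Module.finrank ℝ E = 7 + 1) := ⟨by
    rw [← Module.finrank_mul_finrank ℝ ℂ E]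
    simp⟩
  exact Submodule.finrank_orthogonal_span_singleton (sphere_ne_zero p)

/-- The basis of the tangent space at `p = U p₀` which is the image under `U` of the frame
`s e₁, t e₂, …, t e₇`. -/
def unitaryFrame {U : Matrix (Fin 4) (Fin 4) ℂ} (hU : U ∈ Matrix.unitaryGroup (Fin 4) ℂ) {p : S7}
    (hp : Matrix.toEuclideanLin U (basePoint : E) = p) {s t : ℝ} (hs : s ≠ 0) (ht : t ≠ 0) :
    Module.Basis (Fin 7) ℝ (T p) :=
  Module.Basis.ofEquivFun (LinearMap.linearEquivOfInjective
    (LinearMap.codRestrict (T p) (((Matrix.toEuclideanLin U).restrictScalars ℝ) ∘ₗ frameMap s t)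
      (fun u => by
        rw [mem_tangent, ← hp]
        exact (real_inner_unitary hU _ _).trans (frameMap_tangent s t u)))
    (by
      intro u v huv
      refine frameMap_injective hs ht ?_
      set u' := frameMap s t u
      set v' := frameMap s t v
      have huv' : Matrix.toEuclideanLin U u' = Matrix.toEuclideanLin U v' := congrArg Subtype.val huv
      rw [← sub_eq_zero, ← inner_self_eq_zero (𝕜 := ℂ), ← inner_unitary hU, map_sub, huv', sub_self,
        inner_zero_left])
    (by rw [finrank_tangent, Module.finrank_fin_fun])).symm

theorem coe_unitaryFrame_equivFun {U : Matrix (Fin 4) (Fin 4) ℂ}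
    (hU : U ∈ Matrix.unitaryGroup (Fin 4) ℂ) {p : S7}
    (hp : Matrix.toEuclideanLin U (basePoint : E) = p) {s t : ℝ} (hs : s ≠ 0) (ht : t ≠ 0)
    (v : T p) : (v : E) =
      Matrix.toEuclideanLin U (frameMap s t ((unitaryFrame hU hp hs ht).equivFun v)) := by
  have h := (unitaryFrame hU hp hs ht).equivFun.symm_apply_apply v
  conv_lhs => rw [← h]
  rw [unitaryFrame, Module.Basis.equivFun_ofEquivFun, LinearEquiv.symm_symm]
  rfl

theorem coe_unitaryFrame {U : Matrix (Fin 4) (Fin 4) ℂ}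
    (hU : U ∈ Matrix.unitaryGroup (Fin 4) ℂ) {p : S7}
    (hp : Matrix.toEuclideanLin U (basePoint : E) = p) {s t : ℝ} (hs : s ≠ 0) (ht : t ≠ 0)
    (i : Fin 7) : (unitaryFrame hU hp hs ht i : E) =
      Matrix.toEuclideanLin U (frameMap s t (Pi.single i 1)) := by
  rw [coe_unitaryFrame_equivFun hU hp hs ht (unitaryFrame hU hp hs ht i)]
  congr 2
  ext j
  rw [Module.Basis.equivFun_self, Pi.single_apply]
  exact if_congr eq_comm rfl rfl

/-! ### The values of the forms in a frame -/

/-- The factor `x / 3` in `theta` compensates the entry `3i` of `e₁`, and `c = y - iz` is chosen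
because `Re ((y - iz)(V_R + i V_I)) = y V_R + z V_I`. -/
theorem theta_frameMap_cone (s t x y z : ℝ) (u : Fin 3 → Fin 7 → ℝ) :
    theta x ⟨y, -z⟩ (Matrix.vecCons (basePoint : E) (fun a => frameMap s t (u a))) =
      (x * s * t ^ 2) * (Matrix.det (Matrix.of fun a b => u b (![0, 1, 2] a)) +
        Matrix.det (Matrix.of fun a b => u b (![0, 3, 4] a)) +
        Matrix.det (Matrix.of fun a b => u b (![0, 5, 6] a))) +
      (y * t ^ 3) * (Matrix.det (Matrix.of fun a b => u b (![1, 3, 5] a)) -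
        Matrix.det (Matrix.of fun a b => u b (![1, 4, 6] a)) -
        Matrix.det (Matrix.of fun a b => u b (![2, 3, 6] a)) -
        Matrix.det (Matrix.of fun a b => u b (![2, 4, 5] a))) +
      (z * t ^ 3) * (Matrix.det (Matrix.of fun a b => u b (![2, 3, 5] a)) -
        Matrix.det (Matrix.of fun a b => u b (![2, 4, 6] a)) +
        Matrix.det (Matrix.of fun a b => u b (![1, 3, 6] a)) +
        Matrix.det (Matrix.of fun a b => u b (![1, 4, 5] a))) := by
  rw [theta_apply]
  simp only [kahler, PiLp.inner_apply, Fin.sum_univ_four, Matrix.det_fin_three]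
  rw [Matrix.det_succ_row_zero]
  simp [Matrix.det_fin_three, frameMap_apply, basePoint, Fin.succAbove]
  ring

theorem det_fin_four {R : Type*} [CommRing R] (M : Matrix (Fin 4) (Fin 4) R) : M.det =
    M 0 0 * (M 1 1 * M 2 2 * M 3 3 - M 1 1 * M 2 3 * M 3 2 - M 1 2 * M 2 1 * M 3 3
      + M 1 2 * M 2 3 * M 3 1 + M 1 3 * M 2 1 * M 3 2 - M 1 3 * M 2 2 * M 3 1)
    - M 0 1 * (M 1 0 * M 2 2 * M 3 3 - M 1 0 * M 2 3 * M 3 2 - M 1 2 * M 2 0 * M 3 3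
      + M 1 2 * M 2 3 * M 3 0 + M 1 3 * M 2 0 * M 3 2 - M 1 3 * M 2 2 * M 3 0)
    + M 0 2 * (M 1 0 * M 2 1 * M 3 3 - M 1 0 * M 2 3 * M 3 1 - M 1 1 * M 2 0 * M 3 3
      + M 1 1 * M 2 3 * M 3 0 + M 1 3 * M 2 0 * M 3 1 - M 1 3 * M 2 1 * M 3 0)
    - M 0 3 * (M 1 0 * M 2 1 * M 3 2 - M 1 0 * M 2 2 * M 3 1 - M 1 1 * M 2 0 * M 3 2
      + M 1 1 * M 2 2 * M 3 0 + M 1 2 * M 2 0 * M 3 1 - M 1 2 * M 2 1 * M 3 0) := by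
  rw [Matrix.det_succ_row_zero, Fin.sum_univ_four]
  simp [Matrix.det_fin_three, Fin.succAbove]
  ring

theorem theta_frameMap (s t x y : ℝ) (u : Fin 4 → Fin 7 → ℝ) :
    theta x y (fun a => frameMap s t (u a)) =
      (x / 3 * t ^ 4) * (Matrix.det (Matrix.of fun a b => u b (![1, 2, 3, 4] a)) +
        Matrix.det (Matrix.of fun a b => u b (![1, 2, 5, 6] a)) +
        Matrix.det (Matrix.of fun a b => u b (![3, 4, 5, 6] a))) -
      (3 * y * s * t ^ 3) * (Matrix.det (Matrix.of fun a b => u b (![0, 2, 3, 5] a)) -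
        Matrix.det (Matrix.of fun a b => u b (![0, 2, 4, 6] a)) +
        Matrix.det (Matrix.of fun a b => u b (![0, 1, 3, 6] a)) +
        Matrix.det (Matrix.of fun a b => u b (![0, 1, 4, 5] a))) := by
  have h0 : ∀ a, frameMap s t (u a) 0 = ⟨0, 3 * s * u a 0⟩ := fun _ => rfl
  have h1 : ∀ a, frameMap s t (u a) 1 = ⟨t * u a 1, t * u a 2⟩ := fun _ => rfl
  have h2 : ∀ a, frameMap s t (u a) 2 = ⟨t * u a 3, t * u a 4⟩ := fun _ => rfl
  have h3 : ∀ a, frameMap s t (u a) 3 = ⟨t * u a 5, t * u a 6⟩ := fun _ => rfl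
  have hk : ∀ a b, kahler (frameMap s t (u a)) (frameMap s t (u b)) =
      t ^ 2 * (u a 1 * u b 2 - u a 2 * u b 1 + (u a 3 * u b 4 - u a 4 * u b 3) +
        (u a 5 * u b 6 - u a 6 * u b 5)) := by
    intro a b
    simp only [kahler, PiLp.inner_apply, Fin.sum_univ_four, h0, h1, h2, h3]
    simp
    ring
  have hd : (y * (Matrix.of fun a b => frameMap s t (u a) b).det : ℂ).re =
      -(3 * y * s * t ^ 3) * (Matrix.det (Matrix.of fun a b => u b (![0, 2, 3, 5] a)) -
        Matrix.det (Matrix.of fun a b => u b (![0, 2, 4, 6] a)) +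
        Matrix.det (Matrix.of fun a b => u b (![0, 1, 3, 6] a)) +
        Matrix.det (Matrix.of fun a b => u b (![0, 1, 4, 5] a))) := by
    rw [Complex.re_ofReal_mul, ← Matrix.det_transpose]
    simp only [det_fin_four, Matrix.transpose_apply, Matrix.of_apply, h0, h1, h2, h3,
      Complex.mul_re, Complex.mul_im, Complex.add_re, Complex.add_im, Complex.sub_re,
      Complex.sub_im, Matrix.cons_val]
    ring
  rw [theta_apply, hd]
  simp only [hk, det_fin_four, Matrix.of_apply, Matrix.cons_val]
  ring

end UnitaryFrames

/-! ### The invariant forms `psi`, their Hodge duals and their Laplacian. -/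

section InvariantForms

/-- The invariant form with coefficients `x`, `y`, `z`, where `c = y - i z`. -/
def psi (x : ℝ) (c : ℂ) : Form 3 := coneForm (theta x c)

theorem isSmooth_psi (x : ℝ) (c : ℂ) : IsSmooth (psi x c) := isSmooth_coneForm _

theorem psi_apply_unitary {U : Matrix (Fin 4) (Fin 4) ℂ}
    (hU : U ∈ Matrix.unitaryGroup (Fin 4) ℂ) {p q : S7}
    (hp : (q : E) = Matrix.toEuclideanLin U p) (x : ℝ) (c : ℂ) (w : Fin 3 → T q)
    (v : Fin 3 → E) (h : ∀ i, (w i : E) = Matrix.toEuclideanLin U (v i)) :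
    psi x c q w = theta x (c * U.det) (Matrix.vecCons (p : E) v) := by
  rw [← theta_unitary hU, psi, coneForm_apply]
  congr 1
  ext1 i
  refine Fin.cases ?_ (fun j => ?_) i
  · exact hp
  · exact h j

theorem isInvariant_psi (x : ℝ) (c : ℂ) : IsInvariant (psi x c) := by
  intro A hA p q hpq v w hvw
  rw [Matrix.mem_specialUnitaryGroup_iff] at hA
  rw [psi_apply_unitary hA.1 hpq x c w _ hvw, hA.2, mul_one, psi, coneForm_apply]

section Frames

variable {U : Matrix (Fin 4) (Fin 4) ℂ} (hU : U ∈ Matrix.unitaryGroup (Fin 4) ℂ) {p : S7}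
  (hp : Matrix.toEuclideanLin U (basePoint : E) = p) {s t : ℝ} (hs : s ≠ 0) (ht : t ≠ 0)

theorem psi_unitaryFrame (x y : ℝ) {c : ℂ} (hc : c * U.det = y) :
    (psi x c p).toAlternatingMap = (x * s * t ^ 2) • frameOmega (unitaryFrame hU hp hs ht) +
      (y * t ^ 3) • frameRe (unitaryFrame hU hp hs ht) := by
  ext v
  have h := theta_frameMap_cone s t x y 0 (fun a => (unitaryFrame hU hp hs ht).equivFun (v a))
  have hy : (⟨y, -0⟩ : ℂ) = y := by apply Complex.ext <;> simp
  rw [hy, ← hc, ← psi_apply_unitary hU hp.symm x c v _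
    (fun i => coe_unitaryFrame_equivFun hU hp hs ht (v i)), zero_mul, zero_mul, add_zero] at h
  refine h.trans ?_
  simp only [AlternatingMap.add_apply, AlternatingMap.sub_apply, AlternatingMap.smul_apply,
    frameOmega, frameRe, basisForm_apply, smul_eq_mul]
  rfl

theorem restrictForm_theta_unitaryFrame (x y : ℝ) {c : ℂ} (hc : c * U.det = y) :
    (restrictForm (theta x c) p).toAlternatingMap =
      (x / 3 * t ^ 4) • frameOmegaSq (unitaryFrame hU hp hs ht) -
      (3 * y * s * t ^ 3) • frameIm (unitaryFrame hU hp hs ht) := by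
  ext v
  have h := theta_frameMap s t x y (fun a => (unitaryFrame hU hp hs ht).equivFun (v a))
  rw [← hc, ← theta_unitary hU] at h
  have hv : (fun a => Matrix.toEuclideanLin U
      (frameMap s t ((unitaryFrame hU hp hs ht).equivFun (v a)))) = fun a => (v a : E) :=
    funext fun a => (coe_unitaryFrame_equivFun hU hp hs ht (v a)).symm
  rw [hv] at h
  refine h.trans ?_
  simp only [AlternatingMap.add_apply, AlternatingMap.sub_apply, AlternatingMap.smul_apply,
    frameOmegaSq, frameIm, basisForm_apply, smul_eq_mul]
  rfl

theorem unitaryFrame_rescale {s' t' : ℝ} (hs' : s' ≠ 0) (ht' : t' ≠ 0) (i : Fin 7) :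
    unitaryFrame hU hp hs' ht' i = (if i = 0 then s' / s else t' / t) •
      unitaryFrame hU hp hs ht i := by
  ext1
  rw [Submodule.coe_smul, coe_unitaryFrame, coe_unitaryFrame]
  have : frameMap s' t' (Pi.single i 1) =
      (if i = 0 then s' / s else t' / t) • frameMap s t (Pi.single i 1) := by
    ext j
    fin_cases i <;> fin_cases j <;> apply Complex.ext <;>
      simp [frameMap_apply] <;> field_simp
  rw [this]
  exact ((Matrix.toEuclideanLin U).restrictScalars ℝ).map_smul _ _

end Frames

theorem hasCoefficients_psi (x y z : ℝ) : HasCoefficients (psi x ⟨y, -z⟩) x y z := by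
  rw [HasCoefficients]
  ext u
  have h := theta_frameMap_cone 1 1 x y z u
  have hu : psi x ⟨y, -z⟩ basePoint (fun a => mFrame (u a)) =
      theta x ⟨y, -z⟩ (Matrix.vecCons (basePoint : E) (fun a => frameMap 1 1 (u a))) := by
    rw [psi, coneForm_apply]
    simp only [coe_mFrame]
  refine (hu.trans h).trans ?_
  have hco : ∀ i j k, coframe i j k u = Matrix.det (Matrix.of fun a b => u b (![i, j, k] a)) := by
    intro i j k
    rw [← Matrix.det_transpose]
    rfl
  simp only [AlternatingMap.add_apply, AlternatingMap.sub_apply, AlternatingMap.smul_apply,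
    eOmega, formVR, formVI, hco, smul_eq_mul]
  ring

theorem mFrame_surjective : Function.Surjective mFrame := by
  have hinj : Function.Injective mFrame := by
    intro u v h
    refine frameMap_injective one_ne_zero one_ne_zero ?_
    rw [← coe_mFrame, ← coe_mFrame, h]
  exact (LinearMap.injective_iff_surjective_of_finrank_eq_finrank
    (by rw [finrank_tangent, Module.finrank_fin_fun])).mp hinj

/-- `SU(4)` acts transitively on the sphere, so an invariant form is determined by its value at the
base point. -/
theorem eq_of_hasCoefficients {φ ψ : Form 3} (hφ : IsInvariant φ) (hψ : IsInvariant ψ) {x y z : ℝ}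
    (h1 : HasCoefficients φ x y z) (h2 : HasCoefficients ψ x y z) : φ = ψ := by
  have h0 : ∀ v, φ basePoint v = ψ basePoint v := by
    intro v
    choose u hu using fun i => mFrame_surjective (v i)
    have := congrArg (fun η => η u) (h1.trans h2.symm)
    have hv : v = fun i => mFrame (u i) := funext fun i => (hu i).symm
    rw [hv]
    exact this
  funext p
  ext v
  obtain ⟨U, hU, hp, hdet⟩ := exists_unitary p (c := 1) (by simp)
  have hSU : U ∈ Matrix.specialUnitaryGroup (Fin 4) ℂ :=
    Matrix.mem_specialUnitaryGroup_iff.mpr ⟨hU, hdet⟩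
  let f := unitaryFrame hU hp (s := 1) (t := 1) one_ne_zero one_ne_zero
  have hv : ∀ i, (v i : E) = Matrix.toEuclideanLin U (mFrame (f.equivFun (v i)) : E) := fun i => by
    rw [coe_mFrame]
    exact coe_unitaryFrame_equivFun hU hp one_ne_zero one_ne_zero (v i)
  rw [hφ U hSU basePoint p hp.symm _ v hv, hψ U hSU basePoint p hp.symm _ v hv, h0]

/-! ### The `G₂`-Laplacian -/

/-- The scales `s = R²/A³` and `t = 1/R` solve `A³ s t² = 1` and `R³ t³ = 1`. A negative `A` makes
`s` negative, which is how the sign of `A` enters the orientation. -/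
theorem standard_psi {A R : ℝ} (hA : A ≠ 0) (hR : 0 < R) {c : ℂ}
    {U : Matrix (Fin 4) (Fin 4) ℂ} (hU : U ∈ Matrix.unitaryGroup (Fin 4) ℂ) {p : S7}
    (hp : Matrix.toEuclideanLin U (basePoint : E) = p) (hc : c * U.det = 1)
    (hs : R ^ 2 / A ^ 3 ≠ 0) (ht : 1 / R ≠ 0) :
    (psi (A ^ 3) ((R ^ 3 : ℝ) * c) p).toAlternatingMap =
      frameOmega (unitaryFrame hU hp hs ht) + frameRe (unitaryFrame hU hp hs ht) := by
  rw [psi_unitaryFrame hU hp hs ht (A ^ 3) (R ^ 3) (by rw [mul_assoc, hc, mul_one])]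
  have h1 : A ^ 3 * (R ^ 2 / A ^ 3) * (1 / R) ^ 2 = 1 := by field_simp
  have h2 : R ^ 3 * (1 / R) ^ 3 = 1 := by field_simp
  rw [h1, h2, one_smul, one_smul]

theorem exists_unitary_mul_det (p : S7) {c : ℂ} (hc : ‖c‖ = 1) :
    ∃ U ∈ Matrix.unitaryGroup (Fin 4) ℂ,
      Matrix.toEuclideanLin U (basePoint : E) = p ∧ c * U.det = 1 := by
  obtain ⟨U, hU, hp, hd⟩ := exists_unitary p (c := c⁻¹) (by rw [norm_inv, hc, inv_one])
  refine ⟨U, hU, hp, ?_⟩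
  rw [hd, mul_inv_cancel₀]
  intro h
  rw [h, norm_zero] at hc
  exact zero_ne_one hc

theorem isPositive_psi {A R : ℝ} (hA : A ≠ 0) (hR : 0 < R) {c : ℂ} (hc : ‖c‖ = 1) (p : S7) :
    IsPositive (psi (A ^ 3) ((R ^ 3 : ℝ) * c) p) := by
  obtain ⟨U, hU, hp, hd⟩ := exists_unitary_mul_det p hc
  exact isPositive_standard (standard_psi hA hR hU hp hd (by positivity) (by positivity))

theorem extD_psi (x : ℝ) (c : ℂ) : extD (psi x c) = restrictForm ((4 : ℝ) • theta x c) := by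
  rw [psi, extD_coneForm]
  norm_num

/-- In the adapted frame `dψ` is a combination of `ω²/2` and `f¹ ∧ Im`, which the star turns back
into `f¹ ∧ ω` and `Re`. Comparing coefficients gives the factors `(4/3) t²/s` and `12 s`. Keeping
`X` and `Y` independent of `A` and `R` allows a second application. -/
theorem star43_extD_psi {A R : ℝ} (hA : A ≠ 0) (hR : 0 < R) {c : ℂ} (hc : ‖c‖ = 1) (X Y : ℝ) :
    star43 (psi (A ^ 3) ((R ^ 3 : ℝ) * c)) (extD (psi X (Y * c))) =
      psi (4 / 3 * (A ^ 3 / R ^ 4) * X) ((12 * (R ^ 2 / A ^ 3) * Y : ℝ) * c) := by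
  funext p
  obtain ⟨U, hU, hp, hd⟩ := exists_unitary_mul_det p hc
  have hs : R ^ 2 / A ^ 3 ≠ 0 := by positivity
  have ht : 1 / R ≠ 0 := by positivity
  have hf := isOrientedFrame_induced (standard_psi hA hR hU hp hd hs ht)
  apply ContinuousAlternatingMap.toAlternatingMap_injective
  have h4 : (restrictForm ((4 : ℝ) • theta X (Y * c)) p).toAlternatingMap =
      (4 : ℝ) • (restrictForm (theta X (Y * c)) p).toAlternatingMap := rfl
  rw [star43, hf.hodgeStar_eq (k := 4) (l := 3), extD_psi, h4,
    restrictForm_theta_unitaryFrame hU hp hs ht X Y (by rw [mul_assoc, hd, mul_one]),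
    psi_unitaryFrame hU hp hs ht _ (12 * (R ^ 2 / A ^ 3) * Y) (by rw [mul_assoc, hd, mul_one]),
    map_smul, map_sub, map_smul, map_smul, frameStar_frameOmegaSq hf.2, frameStar_frameIm hf.2,
    smul_sub, smul_smul, smul_smul, smul_neg, sub_neg_eq_add]
  congr 2
  · field_simp
  · ring

/-- The point is that `∗φ` is again the restriction of a constant form, hence closed, so the term
`d∗d∗φ` of the Laplacian vanishes. -/
theorem star34_psi {A R : ℝ} (hA : A ≠ 0) (hR : 0 < R) {c : ℂ} (hc : ‖c‖ = 1) :
    star34 (psi (A ^ 3) ((R ^ 3 : ℝ) * c)) (psi (A ^ 3) ((R ^ 3 : ℝ) * c)) =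
      restrictForm (theta (3 * R ^ 4) ((A ^ 3 * R / 3 : ℝ) * c)) := by
  funext p
  obtain ⟨U, hU, hp, hd⟩ := exists_unitary_mul_det p hc
  have hs : R ^ 2 / A ^ 3 ≠ 0 := by positivity
  have ht : 1 / R ≠ 0 := by positivity
  have hst := standard_psi hA hR hU hp hd hs ht
  have hf := isOrientedFrame_induced hst
  apply ContinuousAlternatingMap.toAlternatingMap_injective
  rw [star34, hf.hodgeStar_eq (k := 3) (l := 4), hst,
    restrictForm_theta_unitaryFrame hU hp hs ht _ (A ^ 3 * R / 3)
      (by rw [mul_assoc, hd, mul_one]), map_add, frameStar_frameOmega hf.2,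
    frameStar_frameRe hf.2, ← sub_eq_add_neg]
  have h1 : 3 * R ^ 4 / 3 * (1 / R) ^ 4 = 1 := by field_simp
  have h2 : 3 * (A ^ 3 * R / 3) * (R ^ 2 / A ^ 3) * (1 / R) ^ 3 = 1 := by field_simp
  rw [h1, h2, one_smul, one_smul]

theorem hodgeStar_zero {V : Type*} [NormedAddCommGroup V] [NormedSpace ℝ V] (k l : ℕ)
    (g : LinearMap.BilinForm ℝ V) (vol : V [⋀^Fin (l + k)]→L[ℝ] ℝ) : hodgeStar k l g vol 0 = 0 := by
  rw [hodgeStar]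
  split_ifs <;> simp

theorem star52_zero (φ : Form 3) : star52 φ 0 = 0 :=
  funext fun _ => hodgeStar_zero 5 2 _ _

theorem extD_zero {k : ℕ} : extD (0 : Form k) = 0 := extD_restrictForm 0

theorem g2Laplacian_psi {A R : ℝ} (hA : A ≠ 0) (hR : 0 < R) {c : ℂ} (hc : ‖c‖ = 1) :
    g2Laplacian (psi (A ^ 3) ((R ^ 3 : ℝ) * c)) =
      psi (16 / 9 * A ^ 9 * R ^ (-8 : ℤ)) ((144 * A ^ (-6 : ℤ) * R ^ 7 : ℝ) * c) := by
  rw [g2Laplacian, hodgeLaplacian, star34_psi hA hR hc, extD_restrictForm, star52_zero, extD_zero,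
    sub_zero, star43_extD_psi hA hR hc, star43_extD_psi hA hR hc]
  have h1 : 4 / 3 * (A ^ 3 / R ^ 4) * (4 / 3 * (A ^ 3 / R ^ 4) * A ^ 3) =
      16 / 9 * A ^ 9 * R ^ (-8 : ℤ) := by
    rw [zpow_neg]
    norm_cast
    field_simp
    norm_num
  have h2 : 12 * (R ^ 2 / A ^ 3) * (12 * (R ^ 2 / A ^ 3) * R ^ 3) =
      144 * A ^ (-6 : ℤ) * R ^ 7 := by
    rw [zpow_neg]
    norm_cast
    field_simp
    norm_num
  rw [h1, h2]

/-- Since the phase is shared, one matrix `U` serves both forms. The adapted frames then differ by a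
diagonal rescaling, whose only factor of uncertain sign has the sign of `A A'`. -/
theorem sameOrientation_psi {A R A' R' : ℝ} (hA : A ≠ 0) (hR : 0 < R) (hR' : 0 < R')
    (hAA : 0 < A * A') {c : ℂ} (hc : ‖c‖ = 1) :
    SameOrientation (psi (A ^ 3) ((R ^ 3 : ℝ) * c)) (psi (A' ^ 3) ((R' ^ 3 : ℝ) * c)) := by
  intro p
  have hA' : A' ≠ 0 := fun h => by simp [h] at hAA
  obtain ⟨U, hU, hp, hd⟩ := exists_unitary_mul_det p hc
  have hs : R ^ 2 / A ^ 3 ≠ 0 := by positivity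
  have ht : 1 / R ≠ 0 := by positivity
  have hs' : R' ^ 2 / A' ^ 3 ≠ 0 := by positivity
  have ht' : 1 / R' ≠ 0 := by positivity
  have hf := isOrientedFrame_induced (standard_psi hA hR hU hp hd hs ht)
  have hf' := isOrientedFrame_induced (standard_psi hA' hR' hU hp hd hs' ht')
  set f := unitaryFrame hU hp hs ht
  set f' := unitaryFrame hU hp hs' ht'
  set vol := inducedVolume (psi (A ^ 3) ((R ^ 3 : ℝ) * c) p)
  set vol' := inducedVolume (psi (A' ^ 3) ((R' ^ 3 : ℝ) * c) p)
  set r : Fin 7 → ℝ := fun i =>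
    if i = 0 then (R' ^ 2 / A' ^ 3) / (R ^ 2 / A ^ 3) else (1 / R') / (1 / R) with hr
  have hrpos : 0 < ∏ i, r i := by
    refine Finset.prod_pos fun i _ => ?_
    simp only [hr]
    split_ifs
    · have h3 : R' ^ 2 / A' ^ 3 / (R ^ 2 / A ^ 3) = R' ^ 2 / R ^ 2 * (A * A') ^ 3 / (A' ^ 2) ^ 3 := by
        field_simp
      rw [h3]
      positivity
    · positivity
  have hfr : (f' : Fin 7 → T p) = fun i => r i • f i :=
    funext fun i => unitaryFrame_rescale hU hp hs ht hs' ht' i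
  have hvol : (∏ i, r i) * vol' f = 1 := by
    have := vol'.toAlternatingMap.toMultilinearMap.map_smul_univ r f
    rw [← hfr] at this
    exact this.symm.trans hf'.2
  refine ⟨(∏ i, r i)⁻¹, inv_pos.mpr hrpos, ?_⟩
  apply ContinuousAlternatingMap.toAlternatingMap_injective
  refine topForm_ext f ?_
  change vol' f = (∏ i, r i)⁻¹ * vol f
  rw [hf.2, mul_one, eq_comm]
  exact inv_eq_of_mul_eq_one_right hvol

end InvariantForms

/-! ### Invariant 3-forms at the base point are combinations of `e¹ ∧ ω`, `V_R` and `V_I`. -/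

section Classification

theorem alternatingMap_ext_strictMono {V : Type*} [AddCommGroup V] [Module ℝ V] {n k : ℕ}
    (b : Module.Basis (Fin n) ℝ V) {η ζ : V [⋀^Fin k]→ₗ[ℝ] ℝ}
    (h : ∀ J : Fin k → Fin n, StrictMono J → η (b ∘ J) = ζ (b ∘ J)) : η = ζ := by
  refine b.ext_alternating fun J hJ => ?_
  change η (b ∘ J) = ζ (b ∘ J)
  have hm : StrictMono (J ∘ Tuple.sort J) :=
    (Tuple.monotone_sort J).strictMono_of_injective (hJ.comp (Tuple.sort J).injective)
  have h1 := h _ hm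
  rw [← Function.comp_assoc, AlternatingMap.map_perm, AlternatingMap.map_perm] at h1
  rcases Int.units_eq_one_or (Equiv.Perm.sign (Tuple.sort J)) with hσ | hσ <;>
    simpa [hσ] using h1

/-- The value of a form at the base point as a 3-form on `ℝ⁷`. -/
def baseForm (φ : Form 3) : (Fin 7 → ℝ) [⋀^Fin 3]→ₗ[ℝ] ℝ :=
  (φ basePoint).toAlternatingMap.compLinearMap mFrame

/-- The coefficients of a form at the base point. -/
def baseCoeff (φ : Form 3) (i j k : Fin 7) : ℝ :=
  baseForm φ ![Pi.single i 1, Pi.single j 1, Pi.single k 1]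

/-- Invariance under a matrix which permutes the frame up to signs. -/
theorem baseCoeff_monomial {φ : Form 3} (hφ : IsInvariant φ) {A : Matrix (Fin 4) (Fin 4) ℂ}
    (hA : A ∈ Matrix.specialUnitaryGroup (Fin 4) ℂ)
    (hp : Matrix.toEuclideanLin A (basePoint : E) = basePoint) {π : Fin 7 → Fin 7} {σ : Fin 7 → ℝ}
    (h : ∀ i, Matrix.toEuclideanLin A (frameMap 1 1 (Pi.single i 1)) =
      frameMap 1 1 (σ i • Pi.single (π i) 1)) (i j k : Fin 7) :
    baseCoeff φ i j k = σ i * σ j * σ k * baseCoeff φ (π i) (π j) (π k) := by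
  have h1 := hφ A hA basePoint basePoint hp.symm
    (fun a => mFrame (Pi.single (![i, j, k] a) 1))
    (fun a => mFrame (σ (![i, j, k] a) • Pi.single (π (![i, j, k] a)) 1))
    (fun a => by rw [coe_mFrame, coe_mFrame, h])
  have h2 := (baseForm φ).toMultilinearMap.map_smul_univ (fun a => σ (![i, j, k] a))
    (fun a => (Pi.single (π (![i, j, k] a)) 1 : Fin 7 → ℝ))
  have h3 : baseCoeff φ i j k =
      φ basePoint (fun a => mFrame (Pi.single (![i, j, k] a) 1)) := by
    rw [baseCoeff]
    change baseForm φ _ = baseForm φ _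
    congr 1
    ext1 a
    fin_cases a <;> rfl
  have h4 : baseCoeff φ (π i) (π j) (π k) =
      baseForm φ (fun a => (Pi.single (π (![i, j, k] a)) 1 : Fin 7 → ℝ)) := by
    rw [baseCoeff]
    congr 1
    ext1 a
    fin_cases a <;> rfl
  rw [h3, h4, ← h1]
  refine h2.trans ?_
  simp [Fin.prod_univ_three]

theorem mem_specialUnitaryGroup_diagonal {a b c : ℂ} (ha : ‖a‖ = 1) (hb : ‖b‖ = 1) (hc : ‖c‖ = 1)
    (h : a * b * c = 1) :
    Matrix.diagonal ![1, a, b, c] ∈ Matrix.specialUnitaryGroup (Fin 4) ℂ := by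
  rw [Matrix.mem_specialUnitaryGroup_iff]
  constructor
  · rw [Matrix.mem_unitaryGroup_iff, Matrix.star_eq_conjTranspose, Matrix.diagonal_conjTranspose,
      Matrix.diagonal_mul_diagonal, ← Matrix.diagonal_one]
    congr 1
    ext i
    fin_cases i <;> simp [Complex.mul_conj, Complex.normSq_eq_norm_sq, ha, hb, hc]
  · rw [Matrix.det_diagonal, Fin.prod_univ_four]
    simpa using h

theorem toEuclideanLin_diagonal (d : Fin 4 → ℂ) (v : E) (i : Fin 4) :
    Matrix.toEuclideanLin (Matrix.diagonal d) v i = d i * v i := by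
  rw [ofLp_toEuclideanLin, Matrix.mulVec_diagonal]

/-- The matrix `diag(1, i, -i, 1)` rotates the first two complex lines of `ℂ³` by opposite quarter
turns. The next lemma does the same for the last two lines. -/
theorem baseCoeff_rotate_left {φ : Form 3} (hφ : IsInvariant φ) (i j k : Fin 7) :
    baseCoeff φ i j k = (![1, 1, -1, -1, 1, 1, 1] : Fin 7 → ℝ) i *
      (![1, 1, -1, -1, 1, 1, 1] : Fin 7 → ℝ) j * (![1, 1, -1, -1, 1, 1, 1] : Fin 7 → ℝ) k *
      baseCoeff φ ((![0, 2, 1, 4, 3, 5, 6] : Fin 7 → Fin 7) i)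
        ((![0, 2, 1, 4, 3, 5, 6] : Fin 7 → Fin 7) j)
        ((![0, 2, 1, 4, 3, 5, 6] : Fin 7 → Fin 7) k) := by
  refine baseCoeff_monomial hφ (A := Matrix.diagonal ![1, Complex.I, -Complex.I, 1])
    (mem_specialUnitaryGroup_diagonal (by simp) (by simp) (by simp) (by simp)) ?_ ?_ i j k
  · ext a
    rw [toEuclideanLin_diagonal]
    fin_cases a <;> simp [basePoint]
  · intro i
    ext a
    rw [toEuclideanLin_diagonal]
    fin_cases i <;> fin_cases a <;> apply Complex.ext <;> simp [frameMap_apply]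

theorem baseCoeff_rotate_right {φ : Form 3} (hφ : IsInvariant φ) (i j k : Fin 7) :
    baseCoeff φ i j k = (![1, 1, 1, 1, -1, -1, 1] : Fin 7 → ℝ) i *
      (![1, 1, 1, 1, -1, -1, 1] : Fin 7 → ℝ) j * (![1, 1, 1, 1, -1, -1, 1] : Fin 7 → ℝ) k *
      baseCoeff φ ((![0, 1, 2, 4, 3, 6, 5] : Fin 7 → Fin 7) i)
        ((![0, 1, 2, 4, 3, 6, 5] : Fin 7 → Fin 7) j)
        ((![0, 1, 2, 4, 3, 6, 5] : Fin 7 → Fin 7) k) := by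
  refine baseCoeff_monomial hφ (A := Matrix.diagonal ![1, 1, Complex.I, -Complex.I])
    (mem_specialUnitaryGroup_diagonal (by simp) (by simp) (by simp) (by simp)) ?_ ?_ i j k
  · ext a
    rw [toEuclideanLin_diagonal]
    fin_cases a <;> simp [basePoint]
  · intro i
    ext a
    rw [toEuclideanLin_diagonal]
    fin_cases i <;> fin_cases a <;> apply Complex.ext <;> simp [frameMap_apply]

theorem baseCoeff_cycle {φ : Form 3} (hφ : IsInvariant φ) (i j k : Fin 7) :
    baseCoeff φ i j k = baseCoeff φ ((![0, 3, 4, 5, 6, 1, 2] : Fin 7 → Fin 7) i)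
        ((![0, 3, 4, 5, 6, 1, 2] : Fin 7 → Fin 7) j)
        ((![0, 3, 4, 5, 6, 1, 2] : Fin 7 → Fin 7) k) := by
  have hA : !![1, 0, 0, 0; 0, 0, 0, 1; 0, 1, 0, 0; 0, 0, 1, 0] ∈
      Matrix.specialUnitaryGroup (Fin 4) ℂ := by
    rw [Matrix.mem_specialUnitaryGroup_iff]
    constructor
    · rw [Matrix.mem_unitaryGroup_iff]
      ext a b
      fin_cases a <;> fin_cases b <;>
        simp [Matrix.mul_apply, Fin.sum_univ_four]
    · rw [det_fin_four]
      simp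
  have := baseCoeff_monomial hφ hA (σ := fun _ => 1) (π := ![0, 3, 4, 5, 6, 1, 2]) ?_ ?_ i j k
  · simpa using this
  · ext a
    rw [ofLp_toEuclideanLin]
    fin_cases a <;> simp [basePoint]
  · intro i
    ext a
    rw [ofLp_toEuclideanLin]
    fin_cases i <;> fin_cases a <;> apply Complex.ext <;>
      simp [frameMap_apply, Matrix.mulVec, dotProduct, Fin.sum_univ_four]

theorem coframe_apply_single (a b c i j k : Fin 7) :
    coframe a b c ![Pi.single i 1, Pi.single j 1, Pi.single k 1] =
      ((Matrix.det (Matrix.of ![![if a = i then 1 else 0, if b = i then 1 else 0,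
        if c = i then 1 else 0], ![if a = j then 1 else 0, if b = j then 1 else 0,
        if c = j then 1 else 0], ![if a = k then 1 else 0, if b = k then 1 else 0,
        if c = k then 1 else 0]]) : ℤ) : ℝ) := by
  have h : coframe a b c ![Pi.single i 1, Pi.single j 1, Pi.single k 1] =
      Matrix.det (Matrix.of fun p q => (![Pi.single i 1, Pi.single j 1, Pi.single k 1] :
        Fin 3 → Fin 7 → ℝ) p (![a, b, c] q)) := rfl
  rw [h, Matrix.det_fin_three, Matrix.det_fin_three]
  simp only [Matrix.of_apply, Matrix.cons_val, Pi.single_apply]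
  push_cast
  rfl

/-- The value of an invariant form at the base point is a combination of `e¹ ∧ ω`, `V_R`, `V_I`. -/
theorem exists_hasCoefficients {φ : Form 3} (hφ : IsInvariant φ) :
    ∃ x y z, HasCoefficients φ x y z := by
  refine ⟨baseCoeff φ 0 1 2, baseCoeff φ 1 3 5, baseCoeff φ 2 3 5, ?_⟩
  refine alternatingMap_ext_strictMono (Pi.basisFun ℝ (Fin 7)) fun J hJ => ?_
  obtain ⟨i, hi⟩ : ∃ i, i = J 0 := ⟨_, rfl⟩
  obtain ⟨j, hj⟩ : ∃ j, j = J 1 := ⟨_, rfl⟩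
  obtain ⟨k, hk⟩ : ∃ k, k = J 2 := ⟨_, rfl⟩
  have hij : i < j := by rw [hi, hj]; exact hJ (by decide)
  have hjk : j < k := by rw [hj, hk]; exact hJ (by decide)
  have hb : (Pi.basisFun ℝ (Fin 7)) ∘ J = ![Pi.single i 1, Pi.single j 1, Pi.single k 1] := by
    ext1 a
    fin_cases a <;> simp [hi, hj, hk]
  rw [hb]
  change baseCoeff φ i j k = _
  simp only [AlternatingMap.add_apply, AlternatingMap.sub_apply, AlternatingMap.smul_apply,
    eOmega, formVR, formVI, coframe_apply_single, ← Int.cast_add, ← Int.cast_sub, smul_eq_mul]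
  clear hb hi hj hk hJ J
  have h1 := baseCoeff_rotate_left hφ
  have h2 := baseCoeff_rotate_right hφ
  have h3 := baseCoeff_cycle hφ
  -- These instances link the surviving coefficients to the three chosen representatives.
  have g1 := h2 1 4 6
  have g2 := h2 2 4 6
  have g3 := h3 0 1 2
  have g4 := h3 0 3 4
  simp only [Matrix.cons_val] at g1 g2 g3 g4
  -- Each rotation is applied twice, `f1` with `f3` and `f2` with `f4`. The squares negate two of
  -- the three complex lines, so a coefficient survives only if all three lines carry equally many
  -- indices modulo two: `e¹` with a full line, or one index from each line.
  have f1 := h1 i j k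
  have f2 := h2 i j k
  have f3 := h1 ((![0, 2, 1, 4, 3, 5, 6] : Fin 7 → Fin 7) i)
    ((![0, 2, 1, 4, 3, 5, 6] : Fin 7 → Fin 7) j) ((![0, 2, 1, 4, 3, 5, 6] : Fin 7 → Fin 7) k)
  have f4 := h2 ((![0, 1, 2, 4, 3, 6, 5] : Fin 7 → Fin 7) i)
    ((![0, 1, 2, 4, 3, 6, 5] : Fin 7 → Fin 7) j) ((![0, 1, 2, 4, 3, 6, 5] : Fin 7 → Fin 7) k)
  clear h1 h2 h3
  generalize baseCoeff φ = B at *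
  fin_cases i <;> fin_cases j <;> first
    | exact absurd hij (by decide)
    | (fin_cases k <;> first
      | exact absurd hjk (by decide)
      | (simp only [Fin.zero_eta, Fin.mk_one, Fin.reduceFinMk, Matrix.cons_val] at f1 f2 f3 f4 ⊢
         simp [Matrix.det_fin_three]
         try linarith))

end Classification

/-! ### The coordinates `A`, `R`, `α`, bijectivity of the Laplacian, and its fixed circles. -/

section Coordinates

theorem HasCoefficients.unique {φ : Form 3} {x y z x' y' z' : ℝ} (h : HasCoefficients φ x y z)
    (h' : HasCoefficients φ x' y' z') : x = x' ∧ y = y' ∧ z = z' := by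
  have h0 := h.symm.trans h'
  have key : ∀ i j k : Fin 7, _ := fun i j k =>
    congrArg (fun η => η ![Pi.single i 1, Pi.single j 1, Pi.single k 1]) h0
  simp only [AlternatingMap.add_apply, AlternatingMap.sub_apply, AlternatingMap.smul_apply,
    eOmega, formVR, formVI, coframe_apply_single, smul_eq_mul] at key
  have k1 := key 0 1 2
  have k2 := key 1 3 5
  have k3 := key 2 3 5
  simp [Matrix.det_fin_three] at k1 k2 k3
  exact ⟨k1, k2, k3⟩

theorem exists_unitary_mul_det_eq_norm (p : S7) (c : ℂ) :
    ∃ U ∈ Matrix.unitaryGroup (Fin 4) ℂ,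
      Matrix.toEuclideanLin U (basePoint : E) = p ∧ c * U.det = (‖c‖ : ℝ) := by
  by_cases hc : c = 0
  · obtain ⟨U, hU, hp, -⟩ := exists_unitary p (c := 1) (by simp)
    exact ⟨U, hU, hp, by simp [hc]⟩
  · have hn : ‖c‖ ≠ 0 := norm_ne_zero_iff.mpr hc
    obtain ⟨U, hU, hp, hd⟩ := exists_unitary_mul_det p (c := c / ‖c‖) (by
      rw [norm_div, Complex.norm_real, norm_norm, div_self hn])
    refine ⟨U, hU, hp, ?_⟩
    have hn' : ((‖c‖ : ℝ) : ℂ) ≠ 0 := by exact_mod_cast hn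
    calc c * U.det = ‖c‖ * (c / ‖c‖ * U.det) := by field_simp
      _ = ‖c‖ := by rw [hd, mul_one]

theorem sevenForm_eq_zero_of_wedge {V : Type*} [NormedAddCommGroup V] [NormedSpace ℝ V]
    {φ : V [⋀^Fin 3]→L[ℝ] ℝ} {X : V} (h : wedge (φ.toAlternatingMap.curryLeft X)
      (φ.toAlternatingMap.curryLeft X) = (0 : V [⋀^Fin (2 + 2)]→ₗ[ℝ] ℝ)) :
    sevenForm φ X X = 0 := by
  rw [sevenForm, h, ← wedgeₗ_apply, map_zero, LinearMap.zero_apply, smul_zero]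

/-- If `x = 0`, contraction with the first frame vector vanishes. If `c = 0`, contraction with the
second is a multiple of a decomposable 2-form, whose wedge square is zero. Either contradicts
definiteness. -/
theorem ne_zero_of_isPositive_psi {x : ℝ} {c : ℂ} (h : IsPositive (psi x c basePoint)) :
    x ≠ 0 ∧ c ≠ 0 := by
  obtain ⟨U, hU, hp, hd⟩ := exists_unitary_mul_det_eq_norm basePoint c
  have hf := psi_unitaryFrame hU hp (s := 1) (t := 1) one_ne_zero one_ne_zero x ‖c‖ hd
  set f := unitaryFrame hU hp (s := 1) (t := 1) one_ne_zero one_ne_zero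
  simp only [one_pow, mul_one] at hf
  constructor
  · rintro rfl
    refine h.sevenForm_ne_zero (f.ne_zero 0) (sevenForm_eq_zero_of_wedge ?_)
    have h0 : (psi 0 c basePoint).toAlternatingMap.curryLeft (f 0) = 0 := by
      rw [hf, zero_smul, zero_add]
      have h1 : (frameRe f).curryLeft (f 0) = 0 := by
        simp only [frameRe, sub_eq_add_neg, ← neg_one_smul ℝ (basisForm f _),
          AlternatingMap.curryLeft_add, AlternatingMap.curryLeft_smul, LinearMap.add_apply,
          LinearMap.smul_apply, basisForm_curryLeft]
        simp [Fin.sum_univ_three]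
      rw [AlternatingMap.curryLeft_smul, LinearMap.smul_apply, h1, smul_zero]
    rw [h0, ← wedgeₗ_apply, map_zero]
  · rintro rfl
    refine h.sevenForm_ne_zero (f.ne_zero 1) (sevenForm_eq_zero_of_wedge ?_)
    have h0 : (psi x 0 basePoint).toAlternatingMap.curryLeft (f 1) =
        (x * -1) • basisForm f (![0, 1, 2] ∘ (1 : Fin 3).succAbove) := by
      rw [hf, norm_zero, zero_smul, add_zero]
      have h1 : (frameOmega f).curryLeft (f 1) =
          (-1 : ℝ) • basisForm f (![0, 1, 2] ∘ (1 : Fin 3).succAbove) := by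
        simp only [frameOmega, AlternatingMap.curryLeft_add, LinearMap.add_apply,
          basisForm_curryLeft]
        simp [Fin.sum_univ_three]
      rw [AlternatingMap.curryLeft_smul, LinearMap.smul_apply, h1, smul_smul]
    rw [h0, ← wedgeₗ_apply, map_smul, map_smul, LinearMap.smul_apply, wedgeₗ_apply,
      wedge_basisForm]
    have h2 : basisForm f (Fin.append (![0, 1, 2] ∘ (1 : Fin 3).succAbove)
        (![0, 1, 2] ∘ (1 : Fin 3).succAbove)) = 0 := by
      ext v
      rw [basisForm_apply]
      exact Matrix.det_zero_of_row_eq (i := (0 : Fin 4)) (j := 2) (by decide) rfl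
    rw [h2, smul_zero, smul_zero]

/-- Real odd roots; the inequality records that the root has the sign of `x`. -/
theorem exists_pow_eq {n : ℕ} (hn : Odd n) {x : ℝ} (hx : x ≠ 0) :
    ∃ a : ℝ, a ^ n = x ∧ 0 < a * x := by
  have hn0 : n ≠ 0 := fun h => by simp [h] at hn
  rcases lt_or_gt_of_ne hx with h | h
  · refine ⟨-((-x) ^ ((n : ℝ)⁻¹)), ?_, ?_⟩
    · rw [hn.neg_pow, Real.rpow_inv_natCast_pow (by linarith) hn0, neg_neg]
    · have : 0 < (-x) ^ ((n : ℝ)⁻¹) := Real.rpow_pos_of_pos (by linarith) _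
      nlinarith
  · exact ⟨x ^ ((n : ℝ)⁻¹), Real.rpow_inv_natCast_pow h.le hn0,
      mul_pos (Real.rpow_pos_of_pos h _) h⟩

/-- The unit complex number `exp (-i α)`. -/
def phase (α : ℝ) : ℂ := ⟨Real.cos α, -Real.sin α⟩

theorem norm_phase (α : ℝ) : ‖phase α‖ = 1 := by
  rw [Complex.norm_def, Complex.normSq_apply]
  change Real.sqrt (Real.cos α * Real.cos α + -Real.sin α * -Real.sin α) = 1
  rw [show Real.cos α * Real.cos α + -Real.sin α * -Real.sin α = 1 by
    have := Real.cos_sq_add_sin_sq α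
    linarith]
  exact Real.sqrt_one

theorem exists_phase {w : ℂ} (hw : ‖w‖ = 1) : ∃ α, w = phase α := by
  -- The minus sign matches the convention that the phase is `exp (-iα)`.
  refine ⟨-w.arg, Complex.ext ?_ ?_⟩
  · rw [phase, Real.cos_neg]
    have := Complex.norm_mul_cos_arg w
    rw [hw, one_mul] at this
    exact this.symm
  · rw [phase, Real.sin_neg, neg_neg]
    have := Complex.norm_mul_sin_arg w
    rw [hw, one_mul] at this
    exact this.symm

theorem hasCoefficients_psi_phase (x r α : ℝ) :
    HasCoefficients (psi x (r * phase α)) x (r * Real.cos α) (r * Real.sin α) := by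
  have h : (r * phase α : ℂ) = ⟨r * Real.cos α, -(r * Real.sin α)⟩ := by
    apply Complex.ext <;> simp [phase]
  rw [h]
  exact hasCoefficients_psi _ _ _

theorem psi_mem {x r : ℝ} (hx : x ≠ 0) (hr : 0 < r) {c : ℂ} (hc : ‖c‖ = 1) :
    psi x (r * c) ∈ invariantPositiveForms := by
  obtain ⟨A, rfl, hA⟩ := exists_pow_eq (n := 3) (by decide) hx
  obtain ⟨R, rfl, hR⟩ := exists_pow_eq (n := 3) (by decide) hr.ne'
  have hA0 : A ≠ 0 := fun h => by simp [h] at hA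
  have hR0 : 0 < R := (pos_iff_pos_of_mul_pos hR).mpr hr
  exact ⟨isSmooth_psi _ _, isInvariant_psi _ _, isPositive_psi hA0 hR0 hc⟩

/-- Combines the classification at the base point, positivity and polar coordinates for `c`;
statements about invariant positive forms reduce through it to explicit ones. -/
theorem eq_psi_of_mem {φ : Form 3} (hφ : φ ∈ invariantPositiveForms) :
    ∃ A R α : ℝ, A ≠ 0 ∧ 0 < R ∧ φ = psi (A ^ 3) ((R ^ 3 : ℝ) * phase α) := by
  obtain ⟨x, y, z, h⟩ := exists_hasCoefficients hφ.2.1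
  obtain rfl : φ = psi x ⟨y, -z⟩ :=
    eq_of_hasCoefficients hφ.2.1 (isInvariant_psi _ _) h (hasCoefficients_psi x y z)
  obtain ⟨hx, hc⟩ := ne_zero_of_isPositive_psi (hφ.2.2 basePoint)
  set c : ℂ := ⟨y, -z⟩
  have hn : 0 < ‖c‖ := norm_pos_iff.mpr hc
  obtain ⟨A, hA, hA'⟩ := exists_pow_eq (n := 3) (by decide) hx
  obtain ⟨R, hR, hR'⟩ := exists_pow_eq (n := 3) (by decide) hn.ne'
  obtain ⟨α, hα⟩ := exists_phase (w := c / ‖c‖) (by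
    rw [norm_div, Complex.norm_real, norm_norm, div_self hn.ne'])
  refine ⟨A, R, α, fun h => by simp [h] at hA', (pos_iff_pos_of_mul_pos hR').mpr hn, ?_⟩
  have hn' : ((‖c‖ : ℝ) : ℂ) ≠ 0 := by exact_mod_cast hn.ne'
  rw [hA, hR, ← hα, mul_div_cancel₀ _ hn']

theorem psi_phase_injective {x r α x' r' α' : ℝ} (hr : 0 < r) (hr' : 0 < r')
    (h : psi x (r * phase α) = psi x' (r' * phase α')) :
    x = x' ∧ r = r' ∧ phase α = phase α' := by
  have h1 := hasCoefficients_psi_phase x r α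
  rw [h] at h1
  obtain ⟨hx, hy, hz⟩ := h1.unique (hasCoefficients_psi_phase x' r' α')
  have hrr : r = r' := by
    have h2 : r ^ 2 = r' ^ 2 := by
      have e1 := Real.cos_sq_add_sin_sq α
      have e2 := Real.cos_sq_add_sin_sq α'
      calc r ^ 2 = (r * Real.cos α) ^ 2 + (r * Real.sin α) ^ 2 := by
            rw [mul_pow, mul_pow, ← mul_add, e1, mul_one]
        _ = r' ^ 2 := by rw [hy, hz, mul_pow, mul_pow, ← mul_add, e2, mul_one]
    exact (pow_left_inj₀ hr.le hr'.le two_ne_zero).mp h2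
  subst hrr
  refine ⟨hx, rfl, Complex.ext (mul_left_cancel₀ hr.ne' hy) ?_⟩
  exact neg_inj.mpr (mul_left_cancel₀ hr.ne' hz)

theorem eq_psi_of_hasCoordinates {φ : Form 3} (hφ : φ ∈ invariantPositiveForms) {A R α : ℝ}
    (h : HasCoordinates φ A R α) : φ = psi (A ^ 3) ((R ^ 3 : ℝ) * phase α) :=
  eq_of_hasCoefficients hφ.2.1 (isInvariant_psi _ _) h (hasCoefficients_psi_phase _ _ _)

theorem hasCoordinates_psi (A R α : ℝ) :
    HasCoordinates (psi (A ^ 3) ((R ^ 3 : ℝ) * phase α)) A R α :=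
  hasCoefficients_psi_phase _ _ _

/-! ### Bijectivity -/

theorem laplacian_coeff_injective {A R A' R' : ℝ} (hA : A ≠ 0) (hR : 0 < R) (hA' : A' ≠ 0)
    (hR' : 0 < R') (h1 : 16 / 9 * A ^ 9 * R ^ (-8 : ℤ) = 16 / 9 * A' ^ 9 * R' ^ (-8 : ℤ))
    (h2 : 144 * A ^ (-6 : ℤ) * R ^ 7 = 144 * A' ^ (-6 : ℤ) * R' ^ 7) : A = A' ∧ R = R' := by
  have e1 : A ^ 9 * R' ^ 8 = A' ^ 9 * R ^ 8 := by
    rw [zpow_neg, zpow_neg] at h1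
    norm_cast at h1
    field_simp at h1
    linarith
  have e2 : R ^ 7 * A' ^ 6 = R' ^ 7 * A ^ 6 := by
    rw [zpow_neg, zpow_neg] at h2
    norm_cast at h2
    field_simp at h2
    linarith
  have e3 : R ^ 5 = R' ^ 5 := by
    have hz : A ^ 18 * A' ^ 18 * (R ^ 16 * R' ^ 16) ≠ 0 := by positivity
    -- The square of the first equation times the cube of the second makes the powers of `A` and
    -- `A'` agree, leaving only `R` and `R'`.
    have : (A ^ 9 * R' ^ 8) ^ 2 * (R ^ 7 * A' ^ 6) ^ 3 =
        (A' ^ 9 * R ^ 8) ^ 2 * (R' ^ 7 * A ^ 6) ^ 3 := by rw [e1, e2]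
    refine mul_left_cancel₀ hz ?_
    linear_combination this
  have e4 : R = R' := (pow_left_inj₀ hR.le hR'.le (by norm_num)).mp e3
  subst e4
  refine ⟨?_, rfl⟩
  have e5 : A ^ 9 = A' ^ 9 := mul_right_cancel₀ (by positivity) e1
  exact (show Odd 9 by decide).strictMono_pow.injective e5

theorem laplacian_coeff_surjective {x r : ℝ} (hx : x ≠ 0) (hr : 0 < r) :
    ∃ A R : ℝ, A ≠ 0 ∧ 0 < R ∧ 16 / 9 * A ^ 9 * R ^ (-8 : ℤ) = x ∧
      144 * A ^ (-6 : ℤ) * R ^ 7 = r := by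
  set P := 9 * x / 16 with hP
  set Q := r / 144 with hQ
  have hP0 : P ≠ 0 := by positivity
  have hQ0 : 0 < Q := by positivity
  -- From `P = A⁹/R⁸` and `Q = R⁷/A⁶` one gets `P² Q³ = R⁵`, which determines `R`; then `A⁹ = P R⁸`
  -- determines `A`.
  obtain ⟨R, hR, hR'⟩ := exists_pow_eq (n := 5) (by decide)
    (x := P ^ 2 * Q ^ 3) (by positivity)
  have hR0 : 0 < R := (pos_iff_pos_of_mul_pos hR').mpr (by positivity)
  obtain ⟨A, hA, hA'⟩ := exists_pow_eq (n := 9) (by decide) (x := P * R ^ 8) (by positivity)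
  have hA0 : A ≠ 0 := fun h => by simp [h] at hA'
  have h6 : A ^ 6 * Q = R ^ 7 := by
    have : (A ^ 6 * Q) ^ 3 = (R ^ 7) ^ 3 := by
      calc (A ^ 6 * Q) ^ 3 = (A ^ 9) ^ 2 * Q ^ 3 := by ring
        _ = R ^ 16 * (P ^ 2 * Q ^ 3) := by rw [hA]; ring
        _ = (R ^ 7) ^ 3 := by rw [← hR]; ring
    exact (pow_left_inj₀ (by positivity) (by positivity) three_ne_zero).mp this
  refine ⟨A, R, hA0, hR0, ?_, ?_⟩
  · rw [hA, zpow_neg]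
    norm_cast
    field_simp
    rw [hP]
    ring
  · rw [← h6, zpow_neg]
    norm_cast
    field_simp
    rw [hQ]
    ring

theorem bijOn_g2Laplacian :
    Set.BijOn g2Laplacian invariantPositiveForms invariantPositiveForms := by
  have hpos : ∀ A R : ℝ, A ≠ 0 → 0 < R → 0 < 144 * A ^ (-6 : ℤ) * R ^ 7 := by
    intro A R hA hR
    have : 0 < A ^ (-6 : ℤ) := Even.zpow_pos (by decide) hA
    positivity
  refine ⟨fun φ hφ => ?_, fun φ hφ ψ hψ h => ?_, fun ψ hψ => ?_⟩
  · obtain ⟨A, R, α, hA, hR, rfl⟩ := eq_psi_of_mem hφ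
    rw [g2Laplacian_psi hA hR (norm_phase α)]
    exact psi_mem (by positivity) (hpos A R hA hR) (norm_phase α)
  · obtain ⟨A, R, α, hA, hR, rfl⟩ := eq_psi_of_mem hφ
    obtain ⟨A', R', α', hA', hR', rfl⟩ := eq_psi_of_mem hψ
    rw [g2Laplacian_psi hA hR (norm_phase α), g2Laplacian_psi hA' hR' (norm_phase α')] at h
    obtain ⟨h1, h2, h3⟩ := psi_phase_injective (hpos A R hA hR) (hpos A' R' hA' hR') h
    obtain ⟨rfl, rfl⟩ := laplacian_coeff_injective hA hR hA' hR' h1 h2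
    rw [h3]
  · obtain ⟨A, R, α, hA, hR, rfl⟩ := eq_psi_of_mem hψ
    obtain ⟨A', R', hA', hR', h1, h2⟩ :=
      laplacian_coeff_surjective (pow_ne_zero 3 hA) (pow_pos hR 3)
    refine ⟨psi (A' ^ 3) ((R' ^ 3 : ℝ) * phase α),
      psi_mem (pow_ne_zero 3 hA') (pow_pos hR' 3) (norm_phase α), ?_⟩
    rw [g2Laplacian_psi hA' hR' (norm_phase α), h1, h2]

theorem sameOrientation_g2Laplacian {φ : Form 3} (hφ : φ ∈ invariantPositiveForms) :
    SameOrientation φ (g2Laplacian φ) := by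
  obtain ⟨A, R, α, hA, hR, rfl⟩ := eq_psi_of_mem hφ
  rw [g2Laplacian_psi hA hR (norm_phase α)]
  have hx : 16 / 9 * A ^ 9 * R ^ (-8 : ℤ) ≠ 0 := by positivity
  have hr : 0 < 144 * A ^ (-6 : ℤ) * R ^ 7 := by
    have : 0 < A ^ (-6 : ℤ) := Even.zpow_pos (by decide) hA
    positivity
  obtain ⟨A', h1, h1'⟩ := exists_pow_eq (n := 3) (by decide) hx
  obtain ⟨R', h2, h2'⟩ := exists_pow_eq (n := 3) (by decide) hr.ne'
  rw [← h1, ← h2]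
  refine sameOrientation_psi hA hR ((pos_iff_pos_of_mul_pos h2').mpr hr) ?_ (norm_phase α)
  have h3 : 0 < R ^ (-8 : ℤ) := by positivity
  -- The new first coefficient is `A` times a positive number, so its cube root `A'` has the sign of
  -- `A`, as orientation requires.
  have h4 : A' * (16 / 9 * A ^ 9 * R ^ (-8 : ℤ)) =
      (A * A') * (16 / 9 * (A ^ 4) ^ 2 * R ^ (-8 : ℤ)) := by ring
  rw [h4] at h1'
  have h5 : 0 < 16 / 9 * (A ^ 4) ^ 2 * R ^ (-8 : ℤ) := by positivity
  exact (pos_iff_pos_of_mul_pos h1').mpr h5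

/-! ### Fixed points -/

theorem cube_fixed : (4 * (3 : ℝ) ^ (1 / 3 : ℝ)) ^ 3 = 192 := by
  have h : ((3 : ℝ) ^ (1 / 3 : ℝ)) ^ 3 = 3 := by
    have := Real.rpow_inv_natCast_pow (x := 3) (by norm_num) (n := 3) (by norm_num)
    rwa [← one_div] at this
  rw [mul_pow, h]
  norm_num

theorem laplacian_coeff_fixed {A R : ℝ} (hA : A ≠ 0) (hR : 0 < R) :
    (16 / 9 * A ^ 9 * R ^ (-8 : ℤ) = A ^ 3 ∧ 144 * A ^ (-6 : ℤ) * R ^ 7 = R ^ 3) ↔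
      (R = 4 ∧ (A ^ 3 = 192 ∨ A ^ 3 = -192)) := by
  have e1 : 16 / 9 * A ^ 9 * R ^ (-8 : ℤ) = A ^ 3 ↔ 16 * (A ^ 3) ^ 2 = 9 * R ^ 8 := by
    rw [zpow_neg]
    norm_cast
    constructor
    · intro h
      field_simp at h
      linarith
    · intro h
      field_simp
      linarith
  have e2 : 144 * A ^ (-6 : ℤ) * R ^ 7 = R ^ 3 ↔ 144 * R ^ 4 = (A ^ 3) ^ 2 := by
    rw [zpow_neg]
    norm_cast
    constructor
    · intro h
      field_simp at h
      linarith
    · intro h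
      field_simp
      linarith
  rw [e1, e2]
  constructor
  · rintro ⟨h1, h2⟩
    -- Eliminating `A` between the two equations gives `9 R⁸ = 16 · 144 R⁴`.
    have h3 : R ^ 4 = 4 ^ 4 := by
      have : R ^ 4 ≠ 0 := by positivity
      refine mul_left_cancel₀ this ?_
      linear_combination -(1 / 9) * h1 - (16 / 9) * h2
    have h4 : R = 4 := (pow_left_inj₀ hR.le (by norm_num) (by norm_num)).mp h3
    refine ⟨h4, ?_⟩
    rw [h4] at h2
    have h5 : (A ^ 3) ^ 2 = 192 ^ 2 := by rw [← h2]; norm_num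
    exact sq_eq_sq_iff_eq_or_eq_neg.mp h5
  · rintro ⟨rfl, h | h⟩ <;> rw [h] <;> norm_num

theorem fixedPoints_eq :
    {φ | φ ∈ invariantPositiveForms ∧ g2Laplacian φ = φ} =
      coordinateCircle (4 * (3 : ℝ) ^ (1 / 3 : ℝ)) 4 ∪
        coordinateCircle (-(4 * (3 : ℝ) ^ (1 / 3 : ℝ))) 4 := by
  have hc := cube_fixed
  set a := 4 * (3 : ℝ) ^ (1 / 3 : ℝ)
  have hc' : (-a) ^ 3 = -192 := by rw [Odd.neg_pow (by decide), hc]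
  have ha : a ≠ 0 := fun h => by norm_num [h] at hc
  ext φ
  constructor
  · rintro ⟨hφ, hfix⟩
    obtain ⟨A, R, α, hA, hR, rfl⟩ := eq_psi_of_mem hφ
    have hr : 0 < 144 * A ^ (-6 : ℤ) * R ^ 7 := by
      have : 0 < A ^ (-6 : ℤ) := Even.zpow_pos (by decide) hA
      positivity
    rw [g2Laplacian_psi hA hR (norm_phase α)] at hfix
    obtain ⟨h1, h2, -⟩ := psi_phase_injective hr (pow_pos hR 3) hfix
    obtain ⟨rfl, h | h⟩ := (laplacian_coeff_fixed hA hR).mp ⟨h1, h2⟩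
    · refine Or.inl ⟨hφ, α, ?_⟩
      rw [h, ← hc]
      exact hasCoordinates_psi a 4 α
    · refine Or.inr ⟨hφ, α, ?_⟩
      rw [h, ← hc']
      exact hasCoordinates_psi (-a) 4 α
  · have key : ∀ b : ℝ, b ≠ 0 → (b ^ 3 = 192 ∨ b ^ 3 = -192) → φ ∈ coordinateCircle b 4 →
        φ ∈ {φ | φ ∈ invariantPositiveForms ∧ g2Laplacian φ = φ} := by
      rintro b hb hb3 ⟨hφ, α, hα⟩
      refine ⟨hφ, ?_⟩
      rw [eq_psi_of_hasCoordinates hφ hα, g2Laplacian_psi hb (by norm_num) (norm_phase α)]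
      obtain ⟨h1, h2⟩ := (laplacian_coeff_fixed hb (R := 4) (by norm_num)).mpr ⟨rfl, hb3⟩
      rw [h1, h2]
    rintro (h | h)
    · exact key a ha (Or.inl hc) h
    · exact key (-a) (neg_ne_zero.mpr ha) (Or.inr hc') h

theorem disjoint_coordinateCircle {a : ℝ} (ha : a ≠ 0) (R : ℝ) :
    Disjoint (coordinateCircle a R) (coordinateCircle (-a) R) := by
  rw [Set.disjoint_left]
  rintro φ ⟨-, α, hα⟩ ⟨-, α', hα'⟩
  have h := (HasCoefficients.unique hα hα').1
  have h' : a = -a := (show Odd 3 by decide).strictMono_pow.injective h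
  exact ha (by linarith)

theorem theta_eq_add (x : ℝ) (c : ℂ) (v : Fin 4 → E) :
    theta x c v = theta x 0 v + c.re * theta 0 1 v + c.im * theta 0 Complex.I v := by
  simp only [theta_apply, Complex.mul_re, Complex.zero_re, Complex.zero_im, Complex.one_re,
    Complex.one_im, Complex.I_re, Complex.I_im]
  ring

/-- At each point `psi` is affine in the real and imaginary parts of `c`, which suffices for the
topology of pointwise convergence. -/
theorem continuous_psi (x : ℝ) : Continuous (psi x) := by
  refine continuous_pi fun p => ?_
  have h : ∀ c, psi x c p = psi x 0 p + c.re • psi 0 1 p + c.im • psi 0 Complex.I p := by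
    intro c
    ext v
    exact theta_eq_add x c _
  have h' : (fun c => psi x c p) =
      fun c => psi x 0 p + c.re • psi 0 1 p + c.im • psi 0 Complex.I p := funext h
  rw [h']
  exact (continuous_const.add (Complex.continuous_re.smul continuous_const)).add
    (Complex.continuous_im.smul continuous_const)

/-- The phase parametrises the set by a continuous bijection from the compact circle to a Hausdorff
space, so continuity of the inverse is automatic. -/
theorem nonempty_homeomorph_coordinateCircle {a R : ℝ} (ha : a ≠ 0) (hR : 0 < R) :
    Nonempty (coordinateCircle a R ≃ₜ Circle) := by
  have hmem : ∀ w : Circle, psi (a ^ 3) ((R ^ 3 : ℝ) * (w : ℂ)) ∈ coordinateCircle a R := by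
    intro w
    refine ⟨psi_mem (pow_ne_zero 3 ha) (pow_pos hR 3) w.norm_coe, ?_⟩
    obtain ⟨α, hα⟩ := exists_phase w.norm_coe
    rw [hα]
    exact ⟨α, hasCoordinates_psi a R α⟩
  let F : Circle → coordinateCircle a R := fun w => ⟨_, hmem w⟩
  have hcont : Continuous F := by
    exact Continuous.subtype_mk ((continuous_psi _).comp
      (continuous_const.mul continuous_subtype_val)) _
  have hbij : Function.Bijective F := by
    constructor
    · intro w w' h
      obtain ⟨α, hα⟩ := exists_phase w.norm_coe
      obtain ⟨α', hα'⟩ := exists_phase w'.norm_coe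
      have h1 : psi (a ^ 3) ((R ^ 3 : ℝ) * (w : ℂ)) = psi (a ^ 3) ((R ^ 3 : ℝ) * (w' : ℂ)) :=
        congrArg Subtype.val h
      rw [hα, hα'] at h1
      obtain ⟨-, -, h2⟩ := psi_phase_injective (pow_pos hR 3) (pow_pos hR 3) h1
      exact Circle.ext (by rw [hα, hα', h2])
    · rintro ⟨φ, hφ, α, hα⟩
      refine ⟨⟨phase α, mem_sphere_zero_iff_norm.mpr (norm_phase α)⟩, Subtype.ext ?_⟩
      exact (eq_psi_of_hasCoordinates hφ hα).symm
  exact ⟨(Continuous.homeoOfEquivCompactToT2 (f := Equiv.ofBijective F hbij) hcont).symm⟩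

end Coordinates
end G2Sphere
end

theorem mainTheorem3 :
    -- `(A, R, α)` are coordinates on the set of invariant positive 3-forms
    (∀ φ ∈ G2Sphere.invariantPositiveForms,
      ∃ A R α : ℝ, A ≠ 0 ∧ 0 < R ∧ G2Sphere.HasCoordinates φ A R α) ∧
    (∀ A R α : ℝ, A ≠ 0 → 0 < R →
      ∃! φ, φ ∈ G2Sphere.invariantPositiveForms ∧ G2Sphere.HasCoordinates φ A R α) ∧
    -- the `G₂`-Laplacian is a bijection which preserves the induced orientation
    Set.BijOn G2Sphere.g2Laplacian
      G2Sphere.invariantPositiveForms G2Sphere.invariantPositiveForms ∧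
    (∀ φ ∈ G2Sphere.invariantPositiveForms,
      G2Sphere.SameOrientation φ (G2Sphere.g2Laplacian φ)) ∧
    -- its explicit form
    (∀ A R α : ℝ, A ≠ 0 → 0 < R → ∀ φ ∈ G2Sphere.invariantPositiveForms,
      G2Sphere.HasCoordinates φ A R α →
        G2Sphere.HasCoefficients (G2Sphere.g2Laplacian φ)
          (16 / 9 * A ^ 9 * R ^ (-8 : ℤ))
          (144 * A ^ (-6 : ℤ) * R ^ 7 * Real.cos α)
          (144 * A ^ (-6 : ℤ) * R ^ 7 * Real.sin α)) ∧
    -- its fixed points form exactly two circles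
    {φ | φ ∈ G2Sphere.invariantPositiveForms ∧ G2Sphere.g2Laplacian φ = φ} =
      G2Sphere.coordinateCircle (4 * (3 : ℝ) ^ (1 / 3 : ℝ)) 4 ∪
        G2Sphere.coordinateCircle (-(4 * (3 : ℝ) ^ (1 / 3 : ℝ))) 4 ∧
    Disjoint (G2Sphere.coordinateCircle (4 * (3 : ℝ) ^ (1 / 3 : ℝ)) 4)
      (G2Sphere.coordinateCircle (-(4 * (3 : ℝ) ^ (1 / 3 : ℝ))) 4) ∧
    Nonempty (G2Sphere.coordinateCircle (4 * (3 : ℝ) ^ (1 / 3 : ℝ)) 4 ≃ₜ Circle) ∧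
    Nonempty (G2Sphere.coordinateCircle (-(4 * (3 : ℝ) ^ (1 / 3 : ℝ))) 4 ≃ₜ Circle) := by
  have ha : (4 * (3 : ℝ) ^ (1 / 3 : ℝ)) ≠ 0 := by positivity
  refine ⟨fun φ hφ => ?_, fun A R α hA hR => ?_, G2Sphere.bijOn_g2Laplacian,
    fun φ hφ => G2Sphere.sameOrientation_g2Laplacian hφ, fun A R α hA hR φ hφ h => ?_,
    G2Sphere.fixedPoints_eq, G2Sphere.disjoint_coordinateCircle ha 4,
    G2Sphere.nonempty_homeomorph_coordinateCircle ha (by norm_num),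
    G2Sphere.nonempty_homeomorph_coordinateCircle (neg_ne_zero.mpr ha) (by norm_num)⟩
  · obtain ⟨A, R, α, hA, hR, rfl⟩ := G2Sphere.eq_psi_of_mem hφ
    exact ⟨A, R, α, hA, hR, G2Sphere.hasCoordinates_psi A R α⟩
  · exact ⟨_, ⟨G2Sphere.psi_mem (pow_ne_zero 3 hA) (pow_pos hR 3) (G2Sphere.norm_phase α),
      G2Sphere.hasCoordinates_psi A R α⟩,
      fun φ hφ => G2Sphere.eq_psi_of_hasCoordinates hφ.1 hφ.2⟩
  · rw [G2Sphere.eq_psi_of_hasCoordinates hφ h,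
      G2Sphere.g2Laplacian_psi hA hR (G2Sphere.norm_phase α)]
    exact G2Sphere.hasCoefficients_psi_phase _ _ α
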